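/- **Setting.** Let $\langle \mathbf z,\mathbf w\rangle=i(\bar z^1w^3-\bar z^3w^1)+\bar z^2w^2$ on $\mathbb C^3$, let $\mathcal S=\{[\mathbf z]\in\mathbb{CP}^2:\langle\mathbf z,\mathbf z\rangle=0\}$ be the $3$-sphere with its standard cr-structure, with contact distribution $\langle \mathbf z,d\mathbf z\rangle=0$, and let $\mathrm G\cong \mathrm{SU}(2,1)$ be the special unitary group of $\langle\cdot,\cdot\rangle$, acting on $\mathcal S$ by $\mathbf A\cdot[\mathbf z]=[\mathbf A\mathbf z]$. A Legendrian curve is a smooth immersion $\gamma:\mathbb R\to\mathcal S$ tangent to the contact distribution. It has a smooth lift $\Gamma$ to $\mathbb C^3\setminus\{0\}$ with $\det(\Gamma,\Gamma',\Gamma'')=i$, unique up to a cubic root of unity; put $a=\mathrm{Im}\langle\Gamma''',\Gamma''\rangle$ and $b=\tfrac12\langle\Gamma'',\Gamma''\rangle$. The curve is *generic* if $a$ vanishes nowhere; it is parametrized by its *natural parameter* if $|a|\equiv1$, and then $\kappa=b$ is its *cr-curvature*. A change of parameter is a smooth diffeomorphism of $\mathbb R$. A curve is *closed* if it is periodic after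 a change of parameter. Two curves $\gamma,\delta$ are *cr-equivalent* if $\delta=\mathbf A\cdot(\gamma\circ h)$ for some $\mathbf A\in\mathrm G$ and some change of parameter $h$. The *Heisenberg projection* $[\mathbf z]\mapsto(\mathrm{Re}(z^2/z^1),\mathrm{Im}(z^2/z^1),\mathrm{Re}(z^3/z^1))$ identifies $\mathcal S\setminus\{[0,0,1]\}$ with $\mathbb R^3$. For $0<r<\sqrt2$ the *standard Heisenberg cyclide* $\mathcal T_r\subset\mathbb R^3$ is the Heisenberg projection of the orbit of $[1,r,ir^2/2]$ under the maximal torus $\{\mathfrak U\,\mathrm{diag}(e^{i\theta},e^{i\phi},e^{-i(\theta+\phi)})\,\mathfrak U^{-1}\}\subset \mathrm G$, where $\mathfrak U=\begin{pmatrix}1/\sqrt2&0&i/\sqrt2\\0&1&0\\i/\sqrt2&0&1/\sqrt2\end{pmatrix}$. It is the torus obtained by rotating around the $Oz$-axis the closed curve $\eta_r=(x_r,y_r,z_r)$, $$x_r=2r\,\frac{2+r^2+(2-r^2)\cos\theta}{4+r^4+(4-r^4)\cos\theta},\quad y_r=-\frac{2r(r^2-2)\sin\theta}{4+r^4+(4-r^4)\cos\theta},\quad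 z_r=\frac{(r^4-4)\sin\theta}{4+r^4+(4-r^4)\cos\theta}.$$ For $q>1$ put $$\mathtt r(q)=\sqrt{2+4q-4\sqrt{q(1+q)}},\qquad \mathtt c(q)=\frac{3\,(16+56\,\mathtt r^4+\mathtt r^8)}{2\,\sqrt[3]{\bigl(2(-64+528\,\mathtt r^4+132\,\mathtt r^8-\mathtt r^{12})\bigr)^2}},\quad \mathtt r=\mathtt r(q),$$ and $\widetilde\gamma_q(t)=\mathrm R_{Oz}(qt)\,\eta_{\mathtt r(q)}(t)$, $t\in\mathbb R$, where $\mathrm R_{Oz}(\theta)$ is the rotation of angle $\theta$ around the $Oz$-axis. **Theorem.** Let $\gamma:\mathbb R\to\mathcal S$ be a generic Legendrian curve whose natural parameter ranges over all of $\mathbb R$ and whose cr-curvature is a constant $c$. Then: 1. $\gamma$ is closed if and only if $c=\mathtt c(q)$ for some rational number $q>1$. 2. If $c=\mathtt c(q)$ with $q=m/n$, $m>n\ge1$ relatively prime integers, then $\gamma$ is cr-equivalent to the curve in $\mathcal S$ whose Heisenberg projection is $\widetilde\gamma_q$. Moreover $\widetilde\gamma_q$ is a solenoidal torus knot of type $(-m,n)$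 on the standard Heisenberg cyclide with parameter $\mathtt r(q)\in(0,\sqrt2)$. Precisely: $t\mapsto\widetilde\gamma_q(-t)$ is a smooth regular curve, periodic with period $2\pi n$ and injective on $[0,2\pi n)$, it lies on $\mathcal T_{\mathtt r(q)}$ and has the form $\mathrm R_{Oz}(\alpha t)\,\eta_{\mathtt r(q)}(\beta t)$ with constants $\alpha,\beta$; over one period it has linking number $-m$ with the upward $Oz$-axis (the axis of the torus) and linking number $n$ with the Clifford circle $x^2+y^2=2,\ z=0$ (the core of the torus), oriented counterclockwise. -/

import Mathlib

open scoped ContDiff Matrix LinearAlgebra.Projectivization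

noncomputable section

namespace CRSphere

/-- The ambient complex vector space. Coordinates are indexed by `0, 1, 2`. -/
abbrev C3 : Type := Fin 3 → ℂ

/-- The matrix `h` of the pseudo-Hermitian product
`⟨z, w⟩ = i (z̄¹ w³ - z̄³ w¹) + z̄² w²`. -/
def hMatrix : Matrix (Fin 3) (Fin 3) ℂ :=
  !![0, 0, Complex.I; 0, 1, 0; -Complex.I, 0, 0]

/-- The pseudo-Hermitian inner product of signature `(2, 1)`, antilinear in the first slot. -/
def herm (z w : C3) : ℂ :=
  Complex.I * (star (z 0) * w 2 - star (z 2) * w 0) + star (z 1) * w 1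

theorem herm_eq (z w : C3) : herm z w = star z ⬝ᵥ (hMatrix *ᵥ w) := by
  simp [herm, hMatrix, Matrix.mulVec, dotProduct, Fin.sum_univ_three]
  ring

/-- The real hyperquadric `⟨z, z⟩ = 0` of the complex projective plane, the model of the 3-sphere
with its standard cr-structure. -/
def hyperquadric : Set (ℙ ℂ C3) := {p | herm p.rep p.rep = 0}

/-- The special pseudo-unitary group of `herm`; it acts on the projective plane through the
Mathlib action of `SL(3, ℂ)`, i.e. `A • [z] = [A z]`, and preserves the hyperquadric. -/
def crGroup : Subgroup (Matrix.SpecialLinearGroup (Fin 3) ℂ) where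
  carrier := {A | (A : Matrix (Fin 3) (Fin 3) ℂ)ᴴ * hMatrix * (A : Matrix (Fin 3) (Fin 3) ℂ)
    = hMatrix}
  one_mem' := by simp
  mul_mem' := by
    intro A B hA hB
    change (A : Matrix (Fin 3) (Fin 3) ℂ)ᴴ * hMatrix * (A : Matrix (Fin 3) (Fin 3) ℂ) = hMatrix at hA
    change (B : Matrix (Fin 3) (Fin 3) ℂ)ᴴ * hMatrix * (B : Matrix (Fin 3) (Fin 3) ℂ) = hMatrix at hB
    change ((A * B : Matrix.SpecialLinearGroup (Fin 3) ℂ) : Matrix (Fin 3) (Fin 3) ℂ)ᴴ * hMatrix *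
      ((A * B : Matrix.SpecialLinearGroup (Fin 3) ℂ) : Matrix (Fin 3) (Fin 3) ℂ) = hMatrix
    rw [Matrix.SpecialLinearGroup.coe_mul, Matrix.conjTranspose_mul]
    generalize (A : Matrix (Fin 3) (Fin 3) ℂ) = M at hA ⊢
    generalize (B : Matrix (Fin 3) (Fin 3) ℂ) = N at hB ⊢
    calc Nᴴ * Mᴴ * hMatrix * (M * N) = Nᴴ * (Mᴴ * hMatrix * M) * N := by
          simp only [Matrix.mul_assoc]
      _ = hMatrix := by rw [hA, hB]
  inv_mem' := by
    intro A hA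
    simp only [Set.mem_ofPred_eq] at hA ⊢
    have h1 : (A : Matrix (Fin 3) (Fin 3) ℂ) * ((A⁻¹ : Matrix.SpecialLinearGroup (Fin 3) ℂ) :
        Matrix (Fin 3) (Fin 3) ℂ) = 1 := by
      rw [← Matrix.SpecialLinearGroup.coe_mul]; simp
    have h2 := congrArg Matrix.conjTranspose h1
    rw [Matrix.conjTranspose_mul, Matrix.conjTranspose_one] at h2
    generalize ((A⁻¹ : Matrix.SpecialLinearGroup (Fin 3) ℂ) : Matrix (Fin 3) (Fin 3) ℂ) = B
      at h1 h2 ⊢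
    calc Bᴴ * hMatrix * B = Bᴴ * (A.1ᴴ * hMatrix * A.1) * B := by rw [hA]
      _ = (Bᴴ * A.1ᴴ) * hMatrix * (A.1 * B) := by simp only [Matrix.mul_assoc]
      _ = hMatrix := by rw [h1, h2]; simp

/-! ### Legendrian curves

A curve is a map from `ℝ` to the projective plane (every open interval is diffeomorphic to `ℝ`). -/

/-- `Γ` is a smooth nowhere vanishing lift of `γ`. -/
def IsSmoothLift (γ : ℝ → ℙ ℂ C3) (Γ : ℝ → C3) : Prop :=
  ContDiff ℝ ∞ Γ ∧ ∀ t, ∃ h : Γ t ≠ 0, γ t = Projectivization.mk ℂ (Γ t) h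

/-- A Legendrian curve: a smooth immersion into the hyperquadric, tangent to the contact
distribution. A map from `ℝ` to the projective plane is smooth if and only if it has a smooth lift
`Γ` (principal bundles over `ℝ` are trivial); it is then an immersion if and only if `Γ t` and
`Γ' t` are linearly independent over `ℂ` for every `t`. The contact form is a nonzero multiple of
`⟨z, dz⟩`. -/
def IsLegendrian (γ : ℝ → ℙ ℂ C3) : Prop :=
  (∀ t, γ t ∈ hyperquadric) ∧
  ∃ Γ : ℝ → C3, IsSmoothLift γ Γ ∧
    (∀ t, LinearIndependent ℂ ![Γ t, deriv Γ t]) ∧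
    ∀ t, herm (Γ t) (deriv Γ t) = 0

/-- A normalized lift: `det (Γ, Γ', Γ'') = i`. -/
def IsNormalizedLift (γ : ℝ → ℙ ℂ C3) (Γ : ℝ → C3) : Prop :=
  IsSmoothLift γ Γ ∧
    ∀ t, (Matrix.of ![Γ t, deriv Γ t, iteratedDeriv 2 Γ t]).det = Complex.I

/-- The density `a = Im ⟨Γ''', Γ''⟩` of the cubic Fubini form. -/
def cubicDensity (Γ : ℝ → C3) (t : ℝ) : ℝ :=
  (herm (iteratedDeriv 3 Γ t) (iteratedDeriv 2 Γ t)).im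

/-- The density `b = ⟨Γ'', Γ''⟩ / 2` of the quadratic Fubini form; `⟨z, z⟩` is always real. -/
def quadraticDensity (Γ : ℝ → C3) (t : ℝ) : ℝ :=
  (herm (iteratedDeriv 2 Γ t) (iteratedDeriv 2 Γ t)).re / 2

/-- The strain density, the real cube root of `|a|`. -/
def strainDensity (Γ : ℝ → C3) (t : ℝ) : ℝ := |cubicDensity Γ t| ^ (1 / 3 : ℝ)

/-- A generic Legendrian curve: the cubic Fubini form vanishes nowhere. The densities do not depend
on the normalized lift, which is unique up to a cubic root of unity. -/
def IsGeneric (γ : ℝ → ℙ ℂ C3) : Prop :=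
  IsLegendrian γ ∧ ∃ Γ, IsNormalizedLift γ Γ ∧ ∀ t, cubicDensity Γ t ≠ 0

/-- A change of parameter: a smooth diffeomorphism of `ℝ`. -/
def IsReparametrization (h : ℝ → ℝ) : Prop :=
  ContDiff ℝ ∞ h ∧ Function.Bijective h ∧ ∀ t, deriv h t ≠ 0

/-- `γ` is a Legendrian curve parametrized by its natural parameter, with cr-curvature `κ`. -/
def IsNaturalWithCurvature (γ : ℝ → ℙ ℂ C3) (κ : ℝ → ℝ) : Prop :=
  IsLegendrian γ ∧ ∃ Γ, IsNormalizedLift γ Γ ∧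
    (∀ t, strainDensity Γ t = 1) ∧ ∀ t, quadraticDensity Γ t = κ t

/-- `γ` has constant cr-curvature `c`: its natural parameter ranges over `ℝ`, and parametrized by
it the curve has cr-curvature identically equal to `c`. -/
def HasConstantCurvature (γ : ℝ → ℙ ℂ C3) (c : ℝ) : Prop :=
  ∃ h, IsReparametrization h ∧ IsNaturalWithCurvature (γ ∘ h) (fun _ => c)

/-- A closed curve: periodic after a change of parameter. -/
def IsClosedCurve (γ : ℝ → ℙ ℂ C3) : Prop :=
  ∃ h, IsReparametrization h ∧ ∃ T : ℝ, 0 < T ∧ Function.Periodic (γ ∘ h) T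

/-- cr-equivalence of curves: congruence under the group after a change of parameter. -/
def CREquivalent (γ δ : ℝ → ℙ ℂ C3) : Prop :=
  ∃ A ∈ crGroup, ∃ h, IsReparametrization h ∧ ∀ t, δ t = A • γ (h t)

/-! ### The Heisenberg picture -/

/-- The Heisenberg projection; meaningful away from the point `[0, 0, 1]` of the hyperquadric. -/
def heisenbergProj (p : ℙ ℂ C3) : Fin 3 → ℝ :=
  ![(p.rep 1 / p.rep 0).re, (p.rep 1 / p.rep 0).im, (p.rep 2 / p.rep 0).re]

/-- The inverse of the Heisenberg projection, `ℝ³ → 𝒮 \ {[0, 0, 1]}`. -/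
def heisenbergInv (v : Fin 3 → ℝ) : ℙ ℂ C3 :=
  Projectivization.mk ℂ
    ![1, (v 0 : ℂ) + v 1 * Complex.I, (v 2 : ℂ) + ((v 0 ^ 2 + v 1 ^ 2) / 2 : ℝ) * Complex.I]
    (fun h => one_ne_zero (congrFun h 0))

theorem herm_smul_self (a : ℂ) (z : C3) : herm (a • z) (a • z) = star a * a * herm z z := by
  simp [herm]; ring

theorem mk_mem_hyperquadric (z : C3) (hz : z ≠ 0) :
    Projectivization.mk ℂ z hz ∈ hyperquadric ↔ herm z z = 0 := by
  obtain ⟨a, ha⟩ := Projectivization.exists_smul_eq_mk_rep ℂ z hz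
  have : herm (Projectivization.mk ℂ z hz).rep (Projectivization.mk ℂ z hz).rep
      = star (a : ℂ) * a * herm z z := by
    rw [← ha, ← herm_smul_self]; rfl
  simp [hyperquadric, this]

theorem heisenbergInv_mem (v : Fin 3 → ℝ) : heisenbergInv v ∈ hyperquadric := by
  unfold heisenbergInv
  rw [mk_mem_hyperquadric]
  simp [herm]
  ring_nf
  simp

theorem heisenbergProj_mk (z : C3) (hz : z ≠ 0) :
    heisenbergProj (Projectivization.mk ℂ z hz)
      = ![(z 1 / z 0).re, (z 1 / z 0).im, (z 2 / z 0).re] := by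
  obtain ⟨a, ha⟩ := Projectivization.exists_smul_eq_mk_rep ℂ z hz
  have hm : ∀ i, (Projectivization.mk ℂ z hz).rep i = (a : ℂ) * z i := by
    intro i; rw [← ha]; rfl
  simp only [heisenbergProj, hm, mul_div_mul_left _ _ a.ne_zero]

theorem heisenbergProj_heisenbergInv (v : Fin 3 → ℝ) :
    heisenbergProj (heisenbergInv v) = v := by
  rw [heisenbergInv, heisenbergProj_mk]
  ext i
  fin_cases i <;> simp [-Complex.ofReal_pow]

/-- The unitary matrix conjugating the maximal torus to the diagonal one. -/
def torusConj : Matrix (Fin 3) (Fin 3) ℂ :=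
  !![1 / (Real.sqrt 2 : ℂ), 0, Complex.I / (Real.sqrt 2 : ℂ);
     0, 1, 0;
     Complex.I / (Real.sqrt 2 : ℂ), 0, 1 / (Real.sqrt 2 : ℂ)]

/-- The matrix `R(θ, φ)` of the maximal torus. -/
def torusMatrix (θ φ : ℝ) : Matrix (Fin 3) (Fin 3) ℂ :=
  torusConj * Matrix.diagonal ![Complex.exp (θ * Complex.I), Complex.exp (φ * Complex.I),
    Complex.exp (-(φ + θ) * Complex.I)] * torusConj⁻¹

/-- The two-dimensional maximal torus of the group. -/
def maximalTorus : Set (Matrix.SpecialLinearGroup (Fin 3) ℂ) :=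
  {A | A ∈ crGroup ∧ ∃ θ φ : ℝ, (A : Matrix (Fin 3) (Fin 3) ℂ) = torusMatrix θ φ}

/-- The point `[1, r, i r² / 2]` of the slice of the torus action. -/
def slicePoint (r : ℝ) : ℙ ℂ C3 :=
  Projectivization.mk ℂ ![1, (r : ℂ), Complex.I * (r : ℂ) ^ 2 / 2]
    (fun h => one_ne_zero (congrFun h 0))

/-- The standard Heisenberg cyclide with parameter `r`, `0 < r < √2`: the Heisenberg picture of the
orbit of the slice point under the maximal torus. -/
def heisenbergCyclide (r : ℝ) : Set (Fin 3 → ℝ) :=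
  heisenbergProj '' {p | ∃ A ∈ maximalTorus, p = A • slicePoint r}

/-- The elliptical profile of the standard Heisenberg cyclide with parameter `r`. -/
def profile (r θ : ℝ) : Fin 3 → ℝ :=
  ![2 * r * ((2 + r ^ 2 + (2 - r ^ 2) * Real.cos θ)
      / (4 + r ^ 4 + (4 - r ^ 4) * Real.cos θ)),
    -(2 * r * (r ^ 2 - 2) * Real.sin θ / (4 + r ^ 4 + (4 - r ^ 4) * Real.cos θ)),
    (r ^ 4 - 4) * Real.sin θ / (4 + r ^ 4 + (4 - r ^ 4) * Real.cos θ)]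

/-- The rotation of angle `θ` around the `Oz`-axis. -/
def rotZ (θ : ℝ) (v : Fin 3 → ℝ) : Fin 3 → ℝ :=
  ![Real.cos θ * v 0 - Real.sin θ * v 1, Real.sin θ * v 0 + Real.cos θ * v 1, v 2]

/-- `f` is a continuous closed path of period `T` in `ℂ \ {0}` (when `f` is `T`-periodic), with
winding number `k` around the origin. -/
def HasWindingNumber (f : ℝ → ℂ) (T : ℝ) (k : ℤ) : Prop :=
  ∃ θ : ℝ → ℝ, Continuous θ ∧
    (∀ t, f t ≠ 0 ∧ f t = (‖f t‖ : ℂ) * Complex.exp (θ t * Complex.I)) ∧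
    θ T - θ 0 = 2 * Real.pi * k

/-- The linking number of a closed curve with the `Oz`-axis oriented upwards is `p`. -/
def LinksAxis (c : ℝ → Fin 3 → ℝ) (T : ℝ) (p : ℤ) : Prop :=
  HasWindingNumber (fun t => (c t 0 : ℂ) + c t 1 * Complex.I) T p

/-- The linking number of a closed curve, disjoint from the `Oz`-axis, with the Clifford circle
`x² + y² = 2, z = 0`, oriented counterclockwise with respect to the upward `Oz`-axis, is `q`. The
circle is the core of the solid tori bounded by the standard Heisenberg cyclides; a closed curve has
linking number `1` with it if, like the `Oz`-axis, it goes around it once passing upwards on the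
inside and downwards on the outside. -/
def LinksCircle (c : ℝ → Fin 3 → ℝ) (T : ℝ) (q : ℤ) : Prop :=
  HasWindingNumber
    (fun t => ((Real.sqrt 2 - Real.sqrt (c t 0 ^ 2 + c t 1 ^ 2) : ℝ) : ℂ) + c t 2 * Complex.I) T q

/-- The curve `c`, of least period `T`, is a solenoidal torus knot of type `(p, q)` on the standard
Heisenberg cyclide with parameter `r`: a regular simple closed curve on the cyclide which moves
uniformly in the two angular coordinates, and winds `p` times around the axis of the torus and
`q` times around its core (signed counts). -/
structure IsSolenoidalTorusKnot (r T : ℝ) (p q : ℤ) (c : ℝ → Fin 3 → ℝ) : Prop where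
  parameter : 0 < r ∧ r < Real.sqrt 2
  period_pos : 0 < T
  smooth : ContDiff ℝ ∞ c
  regular : ∀ t, deriv c t ≠ 0
  periodic : Function.Periodic c T
  simple : Set.InjOn c (Set.Ico 0 T)
  mem_cyclide : ∀ t, c t ∈ heisenbergCyclide r
  solenoidal : ∃ α β : ℝ, ∀ t, c t = rotZ (α * t) (profile r (β * t))
  links_axis : LinksAxis c T p
  links_core : LinksCircle c T q

/-- The function `𝚛(q) = √(2 + 4q - 4√(q(1+q)))`. -/
def rParam (q : ℝ) : ℝ := Real.sqrt (2 + 4 * q - 4 * Real.sqrt (q * (1 + q)))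

/-- The function `𝚌(q)`. The expression inside the power `2/3` is negative for `q > 1`; the power
is the real cube root of its square. -/
def cParam (q : ℝ) : ℝ :=
  3 * (16 + 56 * rParam q ^ 4 + rParam q ^ 8) /
    (2 * ((2 * (-64 + 528 * rParam q ^ 4 + 132 * rParam q ^ 8 - rParam q ^ 12)) ^ 2)
      ^ (1 / 3 : ℝ))

/-- The curve `γ̃_q(t) = R_Oz(q t) η_{𝚛(q)}(t)` in the Heisenberg space. -/
def solenoid (q t : ℝ) : Fin 3 → ℝ := rotZ (q * t) (profile (rParam q) t)

end CRSphere

end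

open CRSphere
open scoped LinearAlgebra.Projectivization

/-!
Let `Γ` be the normalized lift of the curve in its natural parameter. Differentiating
`⟨Γ, Γ⟩ = ⟨Γ, Γ'⟩ = 0` and `det (Γ, Γ', Γ'') = i` determines the Gram matrix of `(Γ, Γ', Γ'')` and
gives the Frenet equation `Γ''' = i ε Γ - 2 c Γ'` with `ε = ±1`
(`IsNaturalWithCurvature.exists_frenetFrame`). For each root `μ` of the real cubic
`X³ - 2 c X + ε`, the function `e^{iμt}` is a linear coordinate of `Γ`: up to sign, the product
with the constant vector `e^{-νt} (Γ'' + ν Γ' + (ν² + 2 c) Γ)`, `ν = i μ̄`. At a double root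
`t e^{iμt}` is a linear coordinate as well.

A closed curve passes twice through a point, at parameters differing by some `τ ≠ 0`. Comparing
linear coordinates excludes non-real and multiple roots, and shows that the differences of the
three real roots are multiples of `2π / τ`, hence commensurable
(`IsFrenetFrame.exists_roots_of_double_point`). Since the roots have sum zero and product `-ε`, up
to a common sign they are `k (2 q + 1) / 3`, `k (1 - q) / 3`, `- k (q + 2) / 3` with `k > 0`, `q > 1`
and `k³ (2 q + 1) (q - 1) (q + 2) = 27`; the number `q` is the ratio of two differences, and the
second elementary symmetric function `-2 c` of the roots is `-2 𝚌(q)` (`cParam_eq`).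

Conversely, the solenoid with parameter `q` is, up to rescaling of `t`, an orbit of a one-parameter
subgroup of the maximal torus with exactly these exponents (`mk_torusPoint`), and the value of
`𝚛(q)` makes the squared lengths of its three eigencomponents proportional to `-(q + 1), 1, q`,
which is what the Gram matrix of a Frenet frame requires (`exists_solenoid_gram`). Two curves with
the same Frenet equation and the same Gram matrix are congruent
(`IsFrenetFrame.exists_congruence`), so every curve with `c = 𝚌(q)` is cr-equivalent to the
solenoid, which is periodic for rational `q`. The winding numbers are computed by comparing the
projected curves with uniformly rotating ones, from which they differ by factors in the right
half-plane (`hasWindingNumber_of_eq_exp_mul`).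
-/

noncomputable section

namespace CRSphere

/-! ### The pseudo-Hermitian product and moving frames -/

theorem herm_add_left (x y z : C3) : herm (x + y) z = herm x z + herm y z := by
  simp [herm]; ring

theorem herm_add_right (x y z : C3) : herm x (y + z) = herm x y + herm x z := by
  simp [herm]; ring

theorem herm_smul_left (a : ℂ) (x y : C3) : herm (a • x) y = star a * herm x y := by
  simp [herm]; ring

theorem herm_smul_right (a : ℂ) (x y : C3) : herm x (a • y) = a * herm x y := by
  simp [herm]; ring

theorem star_herm (x y : C3) : star (herm x y) = herm y x := by
  simp [herm]; ring

theorem herm_self_im (x : C3) : (herm x x).im = 0 := by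
  have h := congrArg Complex.im (star_herm x x)
  simp only [Complex.star_def, Complex.conj_im] at h
  linarith

theorem hasDerivAt_herm {u v : ℝ → C3} {u' v' : C3} {t : ℝ} (hu : HasDerivAt u u' t)
    (hv : HasDerivAt v v' t) :
    HasDerivAt (fun s => herm (u s) (v s)) (herm u' (v t) + herm (u t) v') t := by
  rw [hasDerivAt_pi] at hu hv
  have h := (((hu 0).star.mul (hv 2)).sub ((hu 2).star.mul (hv 0))).const_mul Complex.I
  have h2 := h.add ((hu 1).star.mul (hv 1))
  refine h2.congr_deriv ?_
  simp only [herm]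
  ring

/-- The product rule for a product `⟨u, v⟩` which is constant. -/
theorem herm_deriv_of_const {u v : ℝ → C3} {u' v' : C3} {t : ℝ} {k : ℂ}
    (hu : HasDerivAt u u' t) (hv : HasDerivAt v v' t) (h : ∀ s, herm (u s) (v s) = k) :
    herm u' (v t) + herm (u t) v' = 0 := by
  have h1 := hasDerivAt_herm hu hv
  have h2 : (fun s => herm (u s) (v s)) = fun _ => k := funext h
  rw [h2] at h1
  exact h1.unique (hasDerivAt_const t k)

theorem det_hMatrix : hMatrix.det = -1 := by
  simp [hMatrix, Matrix.det_fin_three]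

theorem gram_eq (x y z : C3) :
    (Matrix.of fun i j => herm (![x, y, z] i) (![x, y, z] j))
      = ((Matrix.of ![x, y, z])ᵀ)ᴴ * hMatrix * (Matrix.of ![x, y, z])ᵀ := by
  ext i j
  simp only [Matrix.of_apply, Matrix.mul_apply, Fin.sum_univ_three, Matrix.conjTranspose_apply,
    Matrix.transpose_apply, herm, hMatrix]
  simp
  ring

/-- The determinant of the Gram matrix of three vectors; the signature enters through
`det hMatrix = -1`. -/
theorem det_gram (x y z : C3) :
    (Matrix.of fun i j => herm (![x, y, z] i) (![x, y, z] j)).det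
      = -(star (Matrix.of ![x, y, z]).det * (Matrix.of ![x, y, z]).det) := by
  rw [gram_eq, Matrix.det_mul, Matrix.det_mul, Matrix.det_conjTranspose, Matrix.det_transpose,
    det_hMatrix]
  ring

/-- The moving frame `(Γ, G₁, G₂) = (Γ, Γ', Γ'')` of the normalized lift of a Legendrian curve in
natural parametrization with constant cr-curvature `c`: the Frenet equation
`Γ''' = i ε Γ - 2 c Γ'`, where `ε = ±1` is the sign of the cubic form, and the six products. -/
structure IsFrenetFrame (ε c : ℝ) (Γ G₁ G₂ : ℝ → C3) : Prop where
  deriv₀ : ∀ t, HasDerivAt Γ (G₁ t) t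
  deriv₁ : ∀ t, HasDerivAt G₁ (G₂ t) t
  deriv₂ : ∀ t, HasDerivAt G₂ ((Complex.I * ε) • Γ t - (2 * c : ℂ) • G₁ t) t
  herm₀₀ : ∀ t, herm (Γ t) (Γ t) = 0
  herm₀₁ : ∀ t, herm (Γ t) (G₁ t) = 0
  herm₀₂ : ∀ t, herm (Γ t) (G₂ t) = -1
  herm₁₁ : ∀ t, herm (G₁ t) (G₁ t) = 1
  herm₁₂ : ∀ t, herm (G₁ t) (G₂ t) = 0
  herm₂₂ : ∀ t, herm (G₂ t) (G₂ t) = 2 * c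

/-- Every smooth lift of a Legendrian curve is isotropic and satisfies the contact condition. -/
theorem IsLegendrian.herm_lift {γ : ℝ → ℙ ℂ C3} (hγ : IsLegendrian γ) {Γ : ℝ → C3}
    (hΓ : IsSmoothLift γ Γ) (t : ℝ) : herm (Γ t) (Γ t) = 0 ∧ herm (Γ t) (deriv Γ t) = 0 := by
  have h0 : ∀ t, herm (Γ t) (Γ t) = 0 := fun t => by
    obtain ⟨h, e⟩ := hΓ.2 t
    exact (mk_mem_hyperquadric _ h).1 (e ▸ hγ.1 t)
  refine ⟨h0 t, ?_⟩
  obtain ⟨-, Γ₀, hΓ₀, -, hc⟩ := hγ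
  have hk : ∀ t, ∃ a : ℂ, a • Γ t = Γ₀ t := fun t => by
    obtain ⟨h, e⟩ := hΓ.2 t
    obtain ⟨h', e'⟩ := hΓ₀.2 t
    exact (Projectivization.mk_eq_mk_iff' ℂ _ _ h' h).1 (e'.symm.trans e)
  have hd : HasDerivAt Γ (deriv Γ t) t :=
    (hΓ.1.differentiable (by simp)).differentiableAt.hasDerivAt
  have hd₀ : HasDerivAt Γ₀ (deriv Γ₀ t) t :=
    (hΓ₀.1.differentiable (by simp)).differentiableAt.hasDerivAt
  -- The two lifts are pointwise proportional, so `⟨Γ₀, Γ⟩` vanishes identically and `⟨Γ₀', Γ⟩ = 0`.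
  have h1 : ∀ s, herm (Γ₀ s) (Γ s) = 0 := fun s => by
    obtain ⟨a, ha⟩ := hk s
    rw [← ha, herm_smul_left, h0, mul_zero]
  have h2 := herm_deriv_of_const hd₀ hd h1
  obtain ⟨a, ha⟩ := hk t
  have ha0 : a ≠ 0 := by
    rintro rfl
    obtain ⟨h', -⟩ := hΓ₀.2 t
    exact h' (by rw [← ha, zero_smul])
  have h3 : herm (Γ t) (deriv Γ₀ t) = 0 := by
    have := hc t
    rw [← ha, herm_smul_left] at this
    exact (mul_eq_zero.1 this).resolve_left (star_ne_zero.2 ha0)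
  have h4 : herm (deriv Γ₀ t) (Γ t) = 0 := by rw [← star_herm, h3, star_zero]
  rw [h4, zero_add, ← ha, herm_smul_left] at h2
  exact (mul_eq_zero.1 h2).resolve_left (star_ne_zero.2 ha0)

theorem exists_coeffs {x y z : C3} (h : (Matrix.of ![x, y, z]).det ≠ 0) (w : C3) :
    ∃ a b c : ℂ, w = a • x + b • y + c • z := by
  have hu : IsUnit (Matrix.of ![x, y, z]).det := isUnit_iff_ne_zero.2 h
  refine ⟨(w ᵥ* (Matrix.of ![x, y, z])⁻¹) 0, (w ᵥ* (Matrix.of ![x, y, z])⁻¹) 1,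
    (w ᵥ* (Matrix.of ![x, y, z])⁻¹) 2, ?_⟩
  have e : w = (w ᵥ* (Matrix.of ![x, y, z])⁻¹) ᵥ* Matrix.of ![x, y, z] := by
    rw [Matrix.vecMul_vecMul, Matrix.nonsing_inv_mul _ hu, Matrix.vecMul_one]
  conv_lhs => rw [e]
  ext i
  simp [Matrix.vecMul, dotProduct, Fin.sum_univ_three]

/-- Differentiating `det (Γ, Γ', Γ'') = const`. -/
theorem det_deriv_of_const {G₀ G₁ G₂ : ℝ → C3} {G₃ : C3} {t : ℝ} {k : ℂ}
    (h₀ : HasDerivAt G₀ (G₁ t) t) (h₁ : HasDerivAt G₁ (G₂ t) t) (h₂ : HasDerivAt G₂ G₃ t)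
    (h : ∀ s, (Matrix.of ![G₀ s, G₁ s, G₂ s]).det = k) :
    (Matrix.of ![G₀ t, G₁ t, G₃]).det = 0 := by
  rw [hasDerivAt_pi] at h₀ h₁ h₂
  have hc : HasDerivAt (fun s => (Matrix.of ![G₀ s, G₁ s, G₂ s]).det) 0 t := by
    rw [show (fun s => (Matrix.of ![G₀ s, G₁ s, G₂ s]).det) = fun _ => k from funext h]
    exact hasDerivAt_const t k
  refine HasDerivAt.unique ?_ hc
  simp only [Matrix.det_fin_three, Matrix.of_apply, Matrix.cons_val]
  refine HasDerivAt.congr_deriv (((((((h₀ 0).mul (h₁ 1)).mul (h₂ 2)).sub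
    (((h₀ 0).mul (h₁ 2)).mul (h₂ 1))).sub (((h₀ 1).mul (h₁ 0)).mul (h₂ 2))).add
    (((h₀ 1).mul (h₁ 2)).mul (h₂ 0))).add (((h₀ 2).mul (h₁ 0)).mul (h₂ 1)) |>.sub
    (((h₀ 2).mul (h₁ 1)).mul (h₂ 0))) ?_
  simp only [Pi.mul_apply]
  ring

/-- The Frenet equations: a natural parametrization with constant cr-curvature has a lift with a
Frenet frame. -/
theorem IsNaturalWithCurvature.exists_frenetFrame {γ : ℝ → ℙ ℂ C3} {c : ℝ}
    (h : IsNaturalWithCurvature γ fun _ => c) :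
    ∃ ε : ℝ, (ε = 1 ∨ ε = -1) ∧ ∃ Γ G₁ G₂ : ℝ → C3, IsFrenetFrame ε c Γ G₁ G₂ ∧
      ∀ t, ∃ hz : Γ t ≠ 0, γ t = Projectivization.mk ℂ (Γ t) hz := by
  obtain ⟨hL, Γ, ⟨hΓ, hdet⟩, hs, hq⟩ := h
  have hL' := hL.herm_lift hΓ
  have hdiff : ∀ k t, HasDerivAt (iteratedDeriv k Γ) (iteratedDeriv (k + 1) Γ t) t := fun k t => by
    rw [iteratedDeriv_succ]
    exact ((hΓ.1.differentiable_iteratedDeriv k (WithTop.coe_lt_coe.2 (ENat.natCast_lt_top k)))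
      t).hasDerivAt
  set G₁ := deriv Γ with hG₁
  set G₂ := iteratedDeriv 2 Γ with hG₂
  set G₃ := iteratedDeriv 3 Γ with hG₃
  have d₀ : ∀ t, HasDerivAt Γ (G₁ t) t := fun t => by
    have := hdiff 0 t
    rwa [iteratedDeriv_zero, zero_add, iteratedDeriv_one] at this
  have d₁ : ∀ t, HasDerivAt G₁ (G₂ t) t := fun t => by
    have := hdiff 1 t
    rwa [iteratedDeriv_one] at this
  have d₂ : ∀ t, HasDerivAt G₂ (G₃ t) t := hdiff 2
  have h00 : ∀ t, herm (Γ t) (Γ t) = 0 := fun t => (hL' t).1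
  have h01 : ∀ t, herm (Γ t) (G₁ t) = 0 := fun t => (hL' t).2
  have h02' : ∀ t, herm (Γ t) (G₂ t) = -herm (G₁ t) (G₁ t) := fun t => by
    linear_combination herm_deriv_of_const (d₀ t) (d₁ t) h01
  have h11 : ∀ t, herm (G₁ t) (G₁ t) = 1 := fun t => by
    have e := det_gram (Γ t) (G₁ t) (G₂ t)
    have e10 : herm (G₁ t) (Γ t) = 0 := by rw [← star_herm, h01, star_zero]
    have e20 : herm (G₂ t) (Γ t) = -herm (G₁ t) (G₁ t) := by
      rw [← star_herm, h02', star_neg, star_herm]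
    rw [hdet, Matrix.det_fin_three] at e
    simp [h00, h01, h02', e10, e20] at e
    obtain ⟨s, hs'⟩ : ∃ s : ℝ, herm (G₁ t) (G₁ t) = s :=
      ⟨_, Complex.ext rfl (by rw [herm_self_im, Complex.ofReal_im])⟩
    rw [hs'] at e ⊢
    have e' : s ^ 3 = 1 := by
      have : ((s ^ 3 : ℝ) : ℂ) = 1 := by push_cast; linear_combination e
      exact_mod_cast this
    have : s = 1 := by nlinarith [sq_nonneg (s + 1), sq_nonneg (s - 1), sq_nonneg s]
    rw [this, Complex.ofReal_one]
  have h02 : ∀ t, herm (Γ t) (G₂ t) = -1 := fun t => by rw [h02', h11]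
  have hx : ∀ t, ∃ x y : ℂ, G₃ t = x • Γ t + y • G₁ t := fun t => by
    obtain ⟨x, y, z, e⟩ := exists_coeffs (by rw [hdet t]; exact Complex.I_ne_zero) (G₃ t)
    have e' := det_deriv_of_const (d₀ t) (d₁ t) (d₂ t) hdet
    have e2 : (Matrix.of ![Γ t, G₁ t, G₃ t]).det
        = z * (Matrix.of ![Γ t, G₁ t, G₂ t]).det := by
      rw [e]
      simp only [Matrix.det_fin_three, Matrix.of_apply, Matrix.cons_val, Pi.add_apply,
        Pi.smul_apply, smul_eq_mul]
      ring
    rw [e', hdet] at e2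
    have hz : z = 0 := by simpa using e2.symm
    exact ⟨x, y, by rw [e, hz, zero_smul, add_zero]⟩
  have h03 : ∀ t, herm (Γ t) (G₃ t) = 0 := fun t => by
    obtain ⟨x, y, e⟩ := hx t
    rw [e, herm_add_right, herm_smul_right, herm_smul_right, h00, h01]; ring
  have h12 : ∀ t, herm (G₁ t) (G₂ t) = 0 := fun t => by
    have := herm_deriv_of_const (d₀ t) (d₂ t) h02
    rwa [h03, add_zero] at this
  have h22 : ∀ t, herm (G₂ t) (G₂ t) = 2 * c := fun t => by
    have := hq t
    rw [quadraticDensity] at this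
    apply Complex.ext
    · simp; linarith
    · rw [herm_self_im]; simp
  -- `a = ±1` is continuous, hence constant.
  have ha : ∀ t, cubicDensity Γ t ^ 2 = 1 := fun t => by
    have := hs t
    rw [strainDensity] at this
    have h3 : |cubicDensity Γ t| = (|cubicDensity Γ t| ^ (1 / 3 : ℝ)) ^ 3 := by
      rw [← Real.rpow_natCast, ← Real.rpow_mul (abs_nonneg _)]; norm_num
    rw [← sq_abs, h3, this, one_pow, one_pow]
  have hac : Continuous (cubicDensity Γ) := by
    have hd : ∀ t, DifferentiableAt ℝ G₃ t := fun t => (hdiff 3 t).differentiableAt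
    refine Complex.continuous_im.comp (continuous_iff_continuousAt.2 fun t => ?_)
    exact (hasDerivAt_herm (hd t).hasDerivAt (d₂ t)).continuousAt
  obtain ⟨ε, hε, hεa⟩ : ∃ ε : ℝ, (ε = 1 ∨ ε = -1) ∧ ∀ t, cubicDensity Γ t = ε := by
    rcases isPreconnected_univ.eq_one_or_eq_neg_one_of_sq_eq hac.continuousOn
      (fun t _ => ha t) with h | h
    · exact ⟨1, Or.inl rfl, fun t => h (Set.mem_univ t)⟩
    · exact ⟨-1, Or.inr rfl, fun t => h (Set.mem_univ t)⟩
  refine ⟨ε, hε, Γ, G₁, G₂, ⟨d₀, d₁, fun t => ?_, h00, h01, h02, h11, h12, h22⟩, hΓ.2⟩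
  convert d₂ t using 1
  obtain ⟨x, y, e⟩ := hx t
  have e10 : herm (G₁ t) (Γ t) = 0 := by rw [← star_herm, h01, star_zero]
  have hy : y = -(2 * c) := by
    have := herm_deriv_of_const (d₁ t) (d₂ t) h12
    rw [h22, e, herm_add_right, herm_smul_right, herm_smul_right, e10, h11] at this
    linear_combination this
  have h32 : herm (G₃ t) (G₂ t) = -star x := by
    rw [e, herm_add_left, herm_smul_left, herm_smul_left, h02, h12]; ring
  have him : (herm (G₃ t) (G₂ t)).im = ε := hεa t
  have hre : (herm (G₃ t) (G₂ t)).re = 0 := by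
    have h1 := herm_deriv_of_const (d₂ t) (d₂ t) h22
    rw [← star_herm (G₃ t) (G₂ t)] at h1
    have := congrArg Complex.re h1
    simp at this
    linarith
  have hx' : x = Complex.I * ε := by
    rw [h32] at him hre
    simp at him hre
    apply Complex.ext <;> simp [him, hre]
  rw [e, hy, hx', neg_smul, sub_eq_add_neg]

/-! ### Exponential solutions of the Frenet equation -/

namespace IsFrenetFrame

variable {ε c : ℝ} {Γ G₁ G₂ : ℝ → C3}

theorem herm₁₀ (F : IsFrenetFrame ε c Γ G₁ G₂) (t : ℝ) : herm (G₁ t) (Γ t) = 0 := by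
  rw [← star_herm, F.herm₀₁, star_zero]

theorem herm₂₀ (F : IsFrenetFrame ε c Γ G₁ G₂) (t : ℝ) : herm (G₂ t) (Γ t) = -1 := by
  rw [← star_herm, F.herm₀₂, star_neg, star_one]

theorem herm₂₁ (F : IsFrenetFrame ε c Γ G₁ G₂) (t : ℝ) : herm (G₂ t) (G₁ t) = 0 := by
  rw [← star_herm, F.herm₁₂, star_zero]

end IsFrenetFrame

/-- For a root `ν` of the characteristic polynomial `X³ + 2 c X - i ε` of the Frenet equation, the
result of applying to `Γ` the cofactor `D² + ν D + (ν² + 2 c)` of `D - ν`. -/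
def eigenvector (c : ℝ) (ν : ℂ) (Γ G₁ G₂ : ℝ → C3) (t : ℝ) : C3 :=
  G₂ t + ν • G₁ t + (ν ^ 2 + 2 * c) • Γ t

theorem hasDerivAt_cexp_mul_ofReal (ν : ℂ) (t : ℝ) :
    HasDerivAt (fun s : ℝ => Complex.exp (ν * s)) (Complex.exp (ν * t) * ν) t := by
  have h : HasDerivAt (fun s : ℝ => ν * (s : ℂ)) ν t := by
    simpa using (Complex.ofRealCLM.hasDerivAt (x := t)).const_mul ν
  exact h.cexp

/-- The linear equation `v' = ν v + e^{ν t} w` with constant `w`, solved by variation of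
constants. -/
theorem eq_of_hasDerivAt_smul {v : ℝ → C3} {ν : ℂ} {w : C3}
    (h : ∀ t, HasDerivAt v (ν • v t + Complex.exp (ν * t) • w) t) (t : ℝ) :
    v t = Complex.exp (ν * t) • (v 0 + (t : ℂ) • w) := by
  have hd : ∀ s : ℝ, HasDerivAt
      (fun s : ℝ => Complex.exp (-ν * s) • v s - (s : ℂ) • w) 0 s := fun s => by
    have h1 := (hasDerivAt_cexp_mul_ofReal (-ν) s).smul (h s)
    have h2 := (Complex.ofRealCLM.hasDerivAt (x := s)).smul_const w
    refine (h1.sub h2).congr_deriv ?_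
    have e : Complex.exp (-ν * s) * Complex.exp (ν * s) = 1 := by
      rw [← Complex.exp_add]; simp
    rw [smul_add, smul_smul (Complex.exp (-ν * s)) (Complex.exp (ν * s)), e]
    simp only [Complex.ofRealCLM_apply, Complex.ofReal_one]
    module
  have hc := is_const_of_deriv_eq_zero (fun s => (hd s).differentiableAt)
    (fun s => (hd s).deriv) t 0
  simp only [Complex.ofReal_zero, mul_zero, Complex.exp_zero, one_smul, zero_smul, sub_zero] at hc
  rw [← hc, sub_add_cancel, smul_smul, ← Complex.exp_add]
  simp

theorem IsFrenetFrame.hasDerivAt_eigenvector {ε c : ℝ} {Γ G₁ G₂ : ℝ → C3}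
    (F : IsFrenetFrame ε c Γ G₁ G₂) {ν : ℂ} (hν : ν ^ 3 + 2 * c * ν = Complex.I * ε) (t : ℝ) :
    HasDerivAt (eigenvector c ν Γ G₁ G₂) (ν • eigenvector c ν Γ G₁ G₂ t) t := by
  refine ((F.deriv₂ t).add ((F.deriv₁ t).const_smul ν) |>.add
    ((F.deriv₀ t).const_smul (ν ^ 2 + 2 * c : ℂ))).congr_deriv ?_
  rw [eigenvector, ← hν]
  module

theorem IsFrenetFrame.eigenvector_eq {ε c : ℝ} {Γ G₁ G₂ : ℝ → C3}
    (F : IsFrenetFrame ε c Γ G₁ G₂) {ν : ℂ} (hν : ν ^ 3 + 2 * c * ν = Complex.I * ε) (t : ℝ) :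
    eigenvector c ν Γ G₁ G₂ t = Complex.exp (ν * t) • eigenvector c ν Γ G₁ G₂ 0 := by
  have := eq_of_hasDerivAt_smul (v := eigenvector c ν Γ G₁ G₂) (ν := ν) (w := 0)
    (fun s => by simpa using F.hasDerivAt_eigenvector hν s) t
  simpa using this

theorem star_cexp_eq {μ : ℂ} (t : ℝ) :
    star (Complex.exp (Complex.I * star μ * t)) * Complex.exp (Complex.I * μ * t) = 1 := by
  rw [Complex.star_def, ← Complex.exp_conj, ← Complex.exp_add]
  simp

theorem conj_char_eq {ε c : ℝ} {μ : ℂ} (hμ : μ ^ 3 - 2 * c * μ + ε = 0) :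
    (Complex.I * star μ) ^ 3 + 2 * c * (Complex.I * star μ) = Complex.I * ε := by
  have h := congrArg star hμ
  simp only [star_add, star_sub, star_mul, star_pow, star_zero, Complex.star_def,
    Complex.conj_ofReal, map_ofNat] at h ⊢
  linear_combination (-Complex.I) * h + Complex.I * (starRingEnd ℂ μ) ^ 3 * Complex.I_sq

/-- The exponential `e^{iμt}` as a linear coordinate of the curve. -/
theorem IsFrenetFrame.herm_eigenvector {ε c : ℝ} {Γ G₁ G₂ : ℝ → C3}
    (F : IsFrenetFrame ε c Γ G₁ G₂) {μ : ℂ} (hμ : μ ^ 3 - 2 * c * μ + ε = 0) (t : ℝ) :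
    herm (eigenvector c (Complex.I * star μ) Γ G₁ G₂ 0) (Γ t)
      = -Complex.exp (Complex.I * μ * t) := by
  have h1 : herm (eigenvector c (Complex.I * star μ) Γ G₁ G₂ t) (Γ t) = -1 := by
    simp only [eigenvector, herm_add_left, herm_smul_left, F.herm₂₀, F.herm₁₀, F.herm₀₀]
    ring
  rw [F.eigenvector_eq (conj_char_eq hμ) t, herm_smul_left] at h1
  linear_combination (Complex.exp (Complex.I * μ * t)) * h1 -
    herm (eigenvector c (Complex.I * star μ) Γ G₁ G₂ 0) (Γ t) * star_cexp_eq (μ := μ) t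

/-- At a double root `t e^{iμt}` is a linear coordinate of the curve too. -/
theorem IsFrenetFrame.exists_herm_eq_of_double_root {ε c : ℝ} {Γ G₁ G₂ : ℝ → C3}
    (F : IsFrenetFrame ε c Γ G₁ G₂) {μ : ℂ} (hμ : μ ^ 3 - 2 * c * μ + ε = 0)
    (hμ' : 3 * μ ^ 2 - 2 * c = 0) :
    ∃ w, ∀ t, herm w (Γ t) = t * Complex.exp (Complex.I * μ * t) := by
  set ν := Complex.I * star μ with hν
  have hν' : 3 * ν ^ 2 + 2 * c = 0 := by
    have h := congrArg star hμ'
    simp only [star_sub, star_mul, star_pow, star_zero, Complex.star_def,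
      Complex.conj_ofReal, map_ofNat] at h hν
    rw [hν]
    linear_combination -h + 3 * (starRingEnd ℂ μ) ^ 2 * Complex.I_sq
  have hd : ∀ t, HasDerivAt (fun s => G₁ s + (2 * ν) • Γ s) (ν • (G₁ t + (2 * ν) • Γ t) +
      Complex.exp (ν * t) • eigenvector c ν Γ G₁ G₂ 0) t := fun t => by
    rw [← F.eigenvector_eq (conj_char_eq hμ) t, eigenvector]
    refine ((F.deriv₁ t).add ((F.deriv₀ t).const_smul (2 * ν))).congr_deriv ?_
    have e : (ν ^ 2 + 2 * c : ℂ) = -2 * ν ^ 2 := by linear_combination hν'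
    rw [e]
    module
  refine ⟨G₁ 0 + (2 * ν) • Γ 0, fun t => ?_⟩
  have h1 : herm (G₁ t + (2 * ν) • Γ t) (Γ t) = 0 := by
    rw [herm_add_left, herm_smul_left, F.herm₁₀, F.herm₀₀]; ring
  have h2 := eq_of_hasDerivAt_smul hd t
  rw [h2, herm_smul_left, herm_add_left, herm_smul_left, F.herm_eigenvector hμ] at h1
  have h3 := star_cexp_eq (μ := μ) t
  rw [← hν] at h3
  simp only [Complex.star_def, Complex.conj_ofReal] at h1 h3
  linear_combination (Complex.exp (Complex.I * μ * t)) * h1 -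
    (herm (G₁ 0 + (2 * ν) • Γ 0) (Γ t) - t * Complex.exp (Complex.I * μ * t)) * h3

/-! ### Curves with a double point -/

/-- If the curve passes twice through the same point, at parameters differing by `τ`, then the
characteristic polynomial `X³ - 2 c X + ε` has three distinct real roots and their
differences are multiples of `2π / τ`. -/
theorem IsFrenetFrame.exists_roots_of_double_point {ε c : ℝ} {Γ G₁ G₂ : ℝ → C3}
    (F : IsFrenetFrame ε c Γ G₁ G₂) {s s' : ℝ} (hs : s' ≠ s) {k : ℂ} (hk : Γ s' = k • Γ s) :
    ∃ x₁ x₂ x₃ : ℝ, x₂ < x₁ ∧ x₃ ≠ x₁ ∧ x₃ ≠ x₂ ∧ x₁ + x₂ + x₃ = 0 ∧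
      x₁ * x₂ + x₁ * x₃ + x₂ * x₃ = -(2 * c) ∧ x₁ * x₂ * x₃ = -ε ∧
      (∃ N : ℤ, (x₁ - x₂) * (s' - s) = 2 * Real.pi * N) ∧
      ∃ N : ℤ, (x₁ - x₃) * (s' - s) = 2 * Real.pi * N := by
  have hexp : ∀ μ : ℂ, μ ^ 3 - 2 * c * μ + ε = 0 →
      Complex.exp (Complex.I * μ * s') = k * Complex.exp (Complex.I * μ * s) := fun μ hμ => by
    have h1 := F.herm_eigenvector hμ s'
    rw [hk, herm_smul_right, F.herm_eigenvector hμ] at h1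
    linear_combination h1
  have hsimple : ∀ μ : ℂ, μ ^ 3 - 2 * c * μ + ε = 0 → 3 * μ ^ 2 - 2 * c ≠ 0 := fun μ hμ hμ' => by
    obtain ⟨w, hw⟩ := F.exists_herm_eq_of_double_root hμ hμ'
    have h1 := hw s'
    rw [hk, herm_smul_right, hw] at h1
    have h2 := hexp μ hμ
    have h3 : ((s' - s : ℝ) : ℂ) * Complex.exp (Complex.I * μ * s') = 0 := by
      push_cast
      linear_combination -h1 - s * h2
    rcases mul_eq_zero.1 h3 with h | h
    · exact hs (sub_eq_zero.1 (Complex.ofReal_eq_zero.1 h))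
    · exact Complex.exp_ne_zero _ h
  have hdiff : ∀ μ μ' : ℂ, μ ^ 3 - 2 * c * μ + ε = 0 → μ' ^ 3 - 2 * c * μ' + ε = 0 →
      Complex.exp (Complex.I * (μ - μ') * (s' - s)) = 1 := fun μ μ' h h' => by
    have e : Complex.I * (μ - μ') * (s' - s)
        = Complex.I * μ * s' - Complex.I * μ * s - (Complex.I * μ' * s' - Complex.I * μ' * s) := by
      ring
    have hk0 : k ≠ 0 := by
      rintro rfl
      exact Complex.exp_ne_zero _ ((hexp μ h).trans (zero_mul _))
    rw [e, Complex.exp_sub, Complex.exp_sub, Complex.exp_sub, hexp μ h, hexp μ' h',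
      mul_div_cancel_right₀ _ (Complex.exp_ne_zero _),
      mul_div_cancel_right₀ _ (Complex.exp_ne_zero _), div_self hk0]
  have hreal : ∀ x y : ℝ, x ^ 3 - 2 * c * x + ε = 0 → y ^ 3 - 2 * c * y + ε = 0 →
      ∃ N : ℤ, (x - y) * (s' - s) = 2 * Real.pi * N := fun x y hx hy => by
    have h := hdiff x y (by exact_mod_cast hx) (by exact_mod_cast hy)
    obtain ⟨N, hN⟩ := Complex.exp_eq_one_iff.1 h
    refine ⟨N, ?_⟩
    have h2 : Complex.I * (((x - y) * (s' - s) : ℝ) : ℂ)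
        = Complex.I * ((2 * Real.pi * N : ℝ) : ℂ) := by
      push_cast
      linear_combination hN
    exact_mod_cast mul_left_cancel₀ Complex.I_ne_zero h2
  -- A real root `x`; the other two are the roots of `X² + x X + (x² - 2c)`.
  obtain ⟨x, hx⟩ : ∃ x : ℝ, x ^ 3 - 2 * c * x + ε = 0 := by
    have hcont : Continuous fun x : ℝ => x ^ 3 - 2 * c * x + ε := by fun_prop
    set R := 1 + 2 * |c| + |ε| with hR
    have hc1 := neg_abs_le c
    have hc2 := le_abs_self c
    have he1 := neg_abs_le ε
    have he2 := le_abs_self ε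
    have hc0 := abs_nonneg c
    have he0 := abs_nonneg ε
    have hR1 : 1 ≤ R := by linarith
    have k1 : 0 ≤ (R - 1) * R * (R + 1) - (R - 1) * R := by
      have : (R - 1) * R * (R + 1) - (R - 1) * R = (R - 1) * R * R := by ring
      rw [this]
      have : 0 ≤ R - 1 := by linarith
      positivity
    have k2 : R * (R - 1 - 2 * |c| - |ε|) = 0 := by rw [hR]; ring
    have k3 : 2 * c * R ≤ 2 * |c| * R := by nlinarith
    have k4 : -(2 * |c| * R) ≤ 2 * c * R := by nlinarith
    have k5 : |ε| ≤ |ε| * R := by nlinarith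
    have := intermediate_value_Icc (show -R ≤ R by linarith) hcont.continuousOn
      (show (0 : ℝ) ∈ _ from ⟨by nlinarith, by nlinarith⟩)
    obtain ⟨x, -, hx⟩ := this
    exact ⟨x, hx⟩
  have hxC : (x : ℂ) ^ 3 - 2 * c * x + ε = 0 := by exact_mod_cast hx
  have hquad : ∀ d : ℂ, d ^ 2 = 8 * c - 3 * x ^ 2 →
      ((-x + d) / 2) ^ 3 - 2 * c * ((-x + d) / 2) + ε = 0 := fun d hd => by
    linear_combination hxC + (d - 3 * x) / 8 * hd
  rcases lt_trichotomy (8 * c - 3 * x ^ 2) 0 with hneg | hzero | hpos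
  · exfalso
    set η := Real.sqrt (3 * x ^ 2 - 8 * c) with hη
    have hη0 : 0 < η := Real.sqrt_pos.2 (by linarith)
    have hη2 : (η : ℂ) ^ 2 = 3 * x ^ 2 - 8 * c := by
      exact_mod_cast Real.sq_sqrt (show 0 ≤ 3 * x ^ 2 - 8 * c by linarith)
    have h := hdiff _ _ (hquad (Complex.I * η) (by
      linear_combination (η : ℂ) ^ 2 * Complex.I_sq - hη2)) (hquad (-(Complex.I * η)) (by
      linear_combination (η : ℂ) ^ 2 * Complex.I_sq - hη2))
    have e : Complex.I * ((-x + Complex.I * η) / 2 - (-x + -(Complex.I * η)) / 2) * (s' - s)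
        = ((-(η * (s' - s)) : ℝ) : ℂ) := by
      push_cast
      linear_combination (η : ℂ) * (s' - s) * Complex.I_sq
    rw [e, ← Complex.ofReal_exp] at h
    have h2 : Real.exp (-(η * (s' - s))) = 1 := by exact_mod_cast h
    rw [Real.exp_eq_one_iff, neg_eq_zero, mul_eq_zero] at h2
    rcases h2 with h2 | h2
    · exact hη0.ne' h2
    · exact hs (sub_eq_zero.1 h2)
  · exfalso
    have hz : (8 * c - 3 * x ^ 2 : ℂ) = 0 := by exact_mod_cast hzero
    refine hsimple _ (hquad 0 (by rw [hz]; ring)) ?_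
    linear_combination (-1 / 4 : ℂ) * hz
  · set d := Real.sqrt (8 * c - 3 * x ^ 2) with hd
    have hd0 : 0 < d := Real.sqrt_pos.2 hpos
    have hd2 : d ^ 2 = 8 * c - 3 * x ^ 2 := Real.sq_sqrt hpos.le
    have h1 : ((-x + d) / 2) ^ 3 - 2 * c * ((-x + d) / 2) + ε = 0 := by
      linear_combination hx + (d - 3 * x) / 8 * hd2
    have h2 : ((-x - d) / 2) ^ 3 - 2 * c * ((-x - d) / 2) + ε = 0 := by
      linear_combination hx + (-d - 3 * x) / 8 * hd2
    have hx' : 3 * x ^ 2 - 2 * c ≠ 0 := fun h => hsimple x hxC (by exact_mod_cast h)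
    refine ⟨(-x + d) / 2, (-x - d) / 2, x, by linarith, ?_, ?_, by ring, ?_, ?_,
      hreal _ _ h1 h2, hreal _ _ h1 hx⟩
    · intro h
      apply hx'
      have : d = 3 * x := by linarith
      rw [this] at hd2
      linarith
    · intro h
      apply hx'
      have : d = -(3 * x) := by linarith
      rw [this] at hd2
      linarith
    · linear_combination (-1 / 4 : ℝ) * hd2
    · linear_combination (-x / 4 : ℝ) * hd2 + hx

/-! ### The parameters `𝚛(q)` and `𝚌(q)` -/

/-- With `w = 𝚛(q)² / 2 = (√(q + 1) - √q)²`, one has `w + 1 / w = 4 q + 2`. -/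
theorem exists_rParam_sq {q : ℝ} (hq : 1 < q) :
    ∃ w : ℝ, 0 < w ∧ w < 1 ∧ w ^ 2 + 1 = (4 * q + 2) * w ∧ rParam q ^ 2 = 2 * w ∧
      0 < rParam q := by
  set s := Real.sqrt (q * (1 + q)) with hs
  have hs2 : s ^ 2 = q * (1 + q) := Real.sq_sqrt (by positivity)
  have hs0 : 0 ≤ s := Real.sqrt_nonneg _
  have h1 : s < q + 1 / 2 := by nlinarith
  have h2 : q < s := by nlinarith
  have h3 : 0 < 2 + 4 * q - 4 * s := by linarith
  refine ⟨1 + 2 * q - 2 * s, by linarith, by linarith, by linear_combination 4 * hs2, ?_, ?_⟩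
  · rw [rParam, Real.sq_sqrt h3.le]; ring
  · exact Real.sqrt_pos.2 h3

theorem rParam_pos {q : ℝ} (hq : 1 < q) : 0 < rParam q := by
  obtain ⟨w, -, -, -, -, h⟩ := exists_rParam_sq hq
  exact h

theorem rParam_lt_sqrt_two {q : ℝ} (hq : 1 < q) : rParam q < Real.sqrt 2 := by
  obtain ⟨w, -, hw1, -, hr, -⟩ := exists_rParam_sq hq
  exact Real.lt_sqrt_of_sq_lt (by rw [hr]; linarith)

theorem rpow_one_third_eq {x y : ℝ} (hy : 0 ≤ y) (h : y ^ 3 = x) : x ^ (1 / 3 : ℝ) = y := by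
  rw [← h, ← Real.rpow_natCast, ← Real.rpow_mul hy]
  norm_num

/-- The function `𝚌` in terms of the roots
`k (2 q + 1) / 3`, `k (1 - q) / 3`, `- k (q + 2) / 3` of the characteristic polynomial. -/
theorem cParam_eq {q k : ℝ} (hq : 1 < q) (hk : 0 < k)
    (h : (2 * q + 1) * (q - 1) * (q + 2) * k ^ 3 = 27) :
    cParam q = k ^ 2 * (q ^ 2 + q + 1) / 6 := by
  obtain ⟨w, hw0, hw1, hw, hr, hr0⟩ := exists_rParam_sq hq
  set P := (2 * q + 1) * (q - 1) * (q + 2) with hP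
  have h4 : rParam q ^ 4 = 4 * w ^ 2 := by
    linear_combination (rParam q ^ 2 + 2 * w) * hr
  have h8 : rParam q ^ 8 = 16 * w ^ 4 := by
    linear_combination (rParam q ^ 4 + 4 * w ^ 2) * h4
  have h12 : rParam q ^ 12 = 64 * w ^ 6 := by
    linear_combination rParam q ^ 4 * h8 + 16 * w ^ 4 * h4
  have hn : 16 + 56 * rParam q ^ 4 + rParam q ^ 8 = 256 * w ^ 2 * (q ^ 2 + q + 1) := by
    rw [h4, h8]
    linear_combination 16 * (w ^ 2 + 1 + (4 * q + 2) * w) * hw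
  have hd : 2 * (-64 + 528 * rParam q ^ 4 + 132 * rParam q ^ 8 - rParam q ^ 12)
      = -4096 * w ^ 3 * P := by
    rw [h4, h8, h12, hP]
    linear_combination (-128 * ((w ^ 2 + 1) ^ 2 + (w ^ 2 + 1) * ((4 * q + 2) * w)
      + ((4 * q + 2) * w) ^ 2) + 4608 * w ^ 2) * hw
  have hroot : ((2 * (-64 + 528 * rParam q ^ 4 + 132 * rParam q ^ 8 - rParam q ^ 12)) ^ 2)
      ^ (1 / 3 : ℝ) = 2304 * w ^ 2 / k ^ 2 := by
    refine rpow_one_third_eq (by positivity) ?_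
    rw [hd]
    have hP' : P = 27 / k ^ 3 := by rw [eq_div_iff (by positivity)]; exact h
    rw [hP']
    field_simp
    norm_num
  rw [cParam, hn, hroot]
  field_simp
  norm_num

theorem exists_scale {q : ℝ} (hq : 1 < q) :
    ∃ k : ℝ, 0 < k ∧ (2 * q + 1) * (q - 1) * (q + 2) * k ^ 3 = 27 := by
  have hq1 : 0 < q - 1 := by linarith
  set P := (2 * q + 1) * (q - 1) * (q + 2) with hP
  have hP0 : 0 < P := by positivity
  refine ⟨(27 / P) ^ (1 / 3 : ℝ), by positivity, ?_⟩
  rw [← Real.rpow_natCast, ← Real.rpow_mul (by positivity)]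
  norm_num
  field_simp

/-- Three ordered reals `x₁ > x₂ > x₃` with vanishing sum, product `1` and commensurable
differences determine a rational value of the parameter. -/
theorem exists_rat_of_ordered_roots {c x₁ x₂ x₃ τ : ℝ} (h12 : x₂ < x₁) (h23 : x₃ < x₂)
    (hsum : x₁ + x₂ + x₃ = 0) (hc : x₁ * x₂ + x₁ * x₃ + x₂ * x₃ = -(2 * c))
    (hprod : x₁ * x₂ * x₃ = 1) (hτ : τ ≠ 0) (hN : ∃ N : ℤ, (x₁ - x₂) * τ = 2 * Real.pi * N)
    (hM : ∃ N : ℤ, (x₁ - x₃) * τ = 2 * Real.pi * N) :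
    ∃ q : ℚ, 1 < q ∧ c = cParam (q : ℝ) := by
  obtain ⟨N, hN⟩ := hN
  obtain ⟨M, hM⟩ := hM
  have hx1 : 0 < x₁ := by linarith
  have hx3 : x₃ < 0 := by linarith
  have hx2 : x₂ < 0 := by
    by_contra h
    have := mul_nonneg hx1.le (not_lt.1 h)
    nlinarith
  have hk : 0 < x₂ - x₃ := by linarith
  have hMN : (x₂ - x₃) * τ = 2 * Real.pi * (M - N : ℤ) := by
    push_cast
    linear_combination hM - hN
  have hπ := Real.pi_pos
  have hMN0 : ((M - N : ℤ) : ℝ) ≠ 0 := by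
    intro h
    rw [h, mul_zero] at hMN
    exact (mul_ne_zero hk.ne' hτ) hMN
  have hq : (((N : ℚ) / (M - N : ℤ) : ℚ) : ℝ) = (x₁ - x₂) / (x₂ - x₃) := by
    push_cast
    push_cast at hMN0 hMN
    rw [div_eq_div_iff hMN0 hk.ne']
    have h2 : (2 * Real.pi * τ) * ((N : ℝ) * (x₂ - x₃))
        = (2 * Real.pi * τ) * ((x₁ - x₂) * (M - N)) := by
      linear_combination (2 * Real.pi * N) * hMN - 2 * Real.pi * (M - N) * hN
    exact mul_left_cancel₀ (by positivity) h2
  have hq1 : 1 < (x₁ - x₂) / (x₂ - x₃) := by rw [lt_div_iff₀ hk]; linarith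
  refine ⟨(N : ℚ) / (M - N : ℤ), by exact_mod_cast hq ▸ hq1, ?_⟩
  have hx1' : x₁ = -x₂ - x₃ := by linarith
  rw [hq, cParam_eq hq1 hk]
  · field_simp
    rw [hx1'] at hc ⊢
    linear_combination 3 * hc
  · have e : ((2 * ((x₁ - x₂) / (x₂ - x₃)) + 1) * ((x₁ - x₂) / (x₂ - x₃) - 1) *
        ((x₁ - x₂) / (x₂ - x₃) + 2) * (x₂ - x₃) ^ 3)
        = (2 * (x₁ - x₂) + (x₂ - x₃)) * ((x₁ - x₂) - (x₂ - x₃)) * ((x₁ - x₂) + 2 * (x₂ - x₃)) := by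
      field_simp
    rw [e]
    rw [hx1'] at hprod ⊢
    linear_combination 27 * hprod

/-- Sorting the roots, and changing their signs if their product is `-1`. -/
theorem exists_rat_of_roots {ε c x₁ x₂ x₃ τ : ℝ} (hε : ε = 1 ∨ ε = -1) (h12 : x₂ < x₁)
    (h13 : x₃ ≠ x₁) (h23 : x₃ ≠ x₂) (hsum : x₁ + x₂ + x₃ = 0)
    (hc : x₁ * x₂ + x₁ * x₃ + x₂ * x₃ = -(2 * c)) (hprod : x₁ * x₂ * x₃ = -ε) (hτ : τ ≠ 0)
    (hN : ∃ N : ℤ, (x₁ - x₂) * τ = 2 * Real.pi * N)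
    (hM : ∃ N : ℤ, (x₁ - x₃) * τ = 2 * Real.pi * N) :
    ∃ q : ℚ, 1 < q ∧ c = cParam (q : ℝ) := by
  have key : ∀ y₁ y₂ y₃ : ℝ, y₂ < y₁ → y₃ < y₂ → y₁ + y₂ + y₃ = 0 →
      y₁ * y₂ + y₁ * y₃ + y₂ * y₃ = -(2 * c) → y₁ * y₂ * y₃ = -ε →
      (∃ N : ℤ, (y₁ - y₂) * τ = 2 * Real.pi * N) → (∃ N : ℤ, (y₁ - y₃) * τ = 2 * Real.pi * N) →
      ∃ q : ℚ, 1 < q ∧ c = cParam (q : ℝ) := by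
    rintro y₁ y₂ y₃ h1 h2 hs hc hp ⟨N, hN⟩ ⟨M, hM⟩
    rcases hε with rfl | rfl
    · refine exists_rat_of_ordered_roots (x₁ := -y₃) (x₂ := -y₂) (x₃ := -y₁) (by linarith)
        (by linarith) (by linarith) (by linarith) (by linarith) hτ ⟨M - N, ?_⟩ ⟨M, ?_⟩
      · push_cast
        linear_combination hM - hN
      · linear_combination hM
    · exact exists_rat_of_ordered_roots h1 h2 hs hc (by linarith) hτ ⟨N, hN⟩ ⟨M, hM⟩
  obtain ⟨N, hN⟩ := hN
  obtain ⟨M, hM⟩ := hM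
  rcases lt_or_gt_of_ne h23 with h | h
  · exact key x₁ x₂ x₃ h12 h hsum hc hprod ⟨N, hN⟩ ⟨M, hM⟩
  · rcases lt_or_gt_of_ne h13 with h' | h'
    · exact key x₁ x₃ x₂ h' h (by linarith) (by linarith) (by linarith) ⟨M, hM⟩ ⟨N, hN⟩
    · refine key x₃ x₁ x₂ h' h12 (by linarith) (by linarith) (by linarith) ⟨-M, ?_⟩ ⟨N - M, ?_⟩
      · push_cast
        linear_combination -hM
      · push_cast
        linear_combination hN - hM

/-- A closed curve passes twice through some point, so its curvature is `𝚌(q)` with `q` rational. -/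
theorem IsClosedCurve.exists_rat {γ : ℝ → ℙ ℂ C3} {c : ℝ} (hγ : IsClosedCurve γ)
    (hc : HasConstantCurvature γ c) : ∃ q : ℚ, 1 < q ∧ c = cParam (q : ℝ) := by
  obtain ⟨h, hh, T, hT, hper⟩ := hγ
  obtain ⟨h₀, hh₀, hnat⟩ := hc
  obtain ⟨ε, hε, Γ, G₁, G₂, F, hΓ⟩ := hnat.exists_frenetFrame
  obtain ⟨s, hs⟩ := hh₀.2.1.2 (h 0)
  obtain ⟨s', hs'⟩ := hh₀.2.1.2 (h T)
  have hne : s' ≠ s := by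
    rintro rfl
    exact hT.ne' (hh.2.1.1 (hs'.symm.trans hs))
  have heq : (γ ∘ h₀) s' = (γ ∘ h₀) s := by
    simp only [Function.comp_apply, hs, hs']
    simpa using hper 0
  obtain ⟨hz, e⟩ := hΓ s
  obtain ⟨hz', e'⟩ := hΓ s'
  rw [e, e'] at heq
  obtain ⟨k, hk⟩ := (Projectivization.mk_eq_mk_iff' ℂ _ _ hz' hz).1 heq
  obtain ⟨x₁, x₂, x₃, h1, h2, h3, h4, h5, h6, h7, h8⟩ :=
    F.exists_roots_of_double_point hne hk.symm
  exact exists_rat_of_roots hε h1 h2 h3 h4 h5 h6 (sub_ne_zero.2 hne) h7 h8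

/-! ### Congruence of curves with the same Frenet equation -/

/-- A pseudo-unitary matrix becomes special after multiplication by a cube root of unit modulus. -/
theorem exists_crGroup_smul {A : Matrix (Fin 3) (Fin 3) ℂ} (hA : Aᴴ * hMatrix * A = hMatrix) :
    ∃ z : ℂ, ∃ B ∈ crGroup, (B : Matrix (Fin 3) (Fin 3) ℂ) = z • A := by
  have hd : star A.det * A.det = 1 := by
    have h := congrArg Matrix.det hA
    rw [Matrix.det_mul, Matrix.det_mul, Matrix.det_conjTranspose, det_hMatrix] at h
    linear_combination -h
  have hn : ‖A.det‖ = 1 := by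
    have h := congrArg norm hd
    rw [norm_mul, norm_star, norm_one] at h
    nlinarith [norm_nonneg A.det]
  have hd0 : A.det ≠ 0 := by
    intro h
    rw [h, norm_zero] at hn
    exact zero_ne_one hn
  obtain ⟨z, hz⟩ := IsAlgClosed.exists_pow_nat_eq (A.det)⁻¹ (n := 3) (by norm_num)
  have hzn : ‖z‖ = 1 := by
    have h := congrArg norm hz
    rw [norm_pow, norm_inv, hn, inv_one] at h
    exact (pow_eq_one_iff_of_nonneg (norm_nonneg z) (by norm_num)).1 h
  have hzz : star z * z = 1 := by
    rw [Complex.star_def, Complex.conj_mul', hzn]; simp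
  have hdet : (z • A).det = 1 := by
    rw [Matrix.det_smul, Fintype.card_fin, hz, inv_mul_cancel₀ hd0]
  refine ⟨z, ⟨z • A, hdet⟩, ?_, rfl⟩
  change (z • A)ᴴ * hMatrix * (z • A) = hMatrix
  rw [Matrix.conjTranspose_smul, Matrix.smul_mul, Matrix.smul_mul, Matrix.mul_smul, smul_smul,
    hzz, one_smul, hA]

/-- The Gram matrix of the Frenet frame. -/
def frenetGram (c : ℝ) : Matrix (Fin 3) (Fin 3) ℂ := !![0, 0, -1; 0, 1, 0; -1, 0, 2 * c]

/-- Let `W` be a matrix whose columns `W_j` are such that the curve `Σ e^{iμ_j t} W_j` has the Gram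
matrix of a Frenet frame, with `μ_j` the roots of the characteristic polynomial. Then a curve with a
Frenet frame is congruent to it, up to a constant factor. -/
theorem IsFrenetFrame.exists_congruence {ε c : ℝ} {Γ G₁ G₂ : ℝ → C3}
    (F : IsFrenetFrame ε c Γ G₁ G₂) {μ : Fin 3 → ℝ}
    (hμ : ∀ j, μ j ^ 3 - 2 * c * μ j + ε = 0) {W : Matrix (Fin 3) (Fin 3) ℂ}
    (hW : (Matrix.of fun j a : Fin 3 => (Complex.I * μ j) ^ (a : ℕ))ᴴ * (Wᴴ * hMatrix * W) *
      (Matrix.of fun j a : Fin 3 => (Complex.I * μ j) ^ (a : ℕ)) = frenetGram c) :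
    ∃ z : ℂ, ∃ A ∈ crGroup, ∀ t, (A : Matrix (Fin 3) (Fin 3) ℂ) *ᵥ Γ t
      = z • W *ᵥ fun j => Complex.exp (Complex.I * μ j * t) := by
  have hμC : ∀ j, (μ j : ℂ) ^ 3 - 2 * c * μ j + ε = 0 := fun j => by exact_mod_cast hμ j
  set M : Matrix (Fin 3) (Fin 3) ℂ := Matrix.of fun j a : Fin 3 => (Complex.I * μ j) ^ (a : ℕ)
  set L : Fin 3 → C3 := fun j => eigenvector c (Complex.I * star (μ j : ℂ)) Γ G₁ G₂ 0 with hL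
  -- The rows of `B` are the linear coordinates `e^{iμ_j t}` of the curve.
  set B : Matrix (Fin 3) (Fin 3) ℂ := Matrix.of fun j => -(star (L j) ᵥ* hMatrix) with hB
  have hBz : ∀ z j, (B *ᵥ z) j = -herm (L j) z := fun z j => by
    rw [herm_eq, Matrix.dotProduct_mulVec, ← neg_dotProduct]
    rfl
  set Φ : Matrix (Fin 3) (Fin 3) ℂ := (Matrix.of ![Γ 0, G₁ 0, G₂ 0])ᵀ with hΦ
  have hgram : Φᴴ * hMatrix * Φ = frenetGram c := by
    rw [hΦ, ← gram_eq]
    ext i j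
    fin_cases i <;> fin_cases j <;>
      simp [frenetGram, F.herm₀₀, F.herm₀₁, F.herm₀₂, F.herm₁₀, F.herm₁₁, F.herm₁₂, F.herm₂₀,
        F.herm₂₁, F.herm₂₂]
  have hΦdet : IsUnit Φ.det := by
    rw [isUnit_iff_ne_zero]
    intro h
    have := congrArg Matrix.det hgram
    rw [Matrix.det_mul, h] at this
    simp [frenetGram, Matrix.det_fin_three] at this
  have hBΦ : B * Φ = M := by
    have hcol : ∀ j a, (B * Φ) j a = (B *ᵥ (![Γ 0, G₁ 0, G₂ 0] a)) j := fun _ _ => rfl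
    ext j a
    rw [hcol, hBz, hL]
    fin_cases a <;>
      simp [M, eigenvector, herm_add_left, herm_smul_left, F.herm₀₀, F.herm₀₁, F.herm₀₂, F.herm₁₀,
        F.herm₁₁, F.herm₁₂, F.herm₂₀, F.herm₂₁, F.herm₂₂]
  have hΦΦ : Φ * Φ⁻¹ = 1 := Matrix.mul_nonsing_inv _ hΦdet
  have hΦΦ' : (Φ⁻¹)ᴴ * Φᴴ = 1 := by
    rw [← Matrix.conjTranspose_mul, hΦΦ, Matrix.conjTranspose_one]
  have hunit : (W * B)ᴴ * hMatrix * (W * B) = hMatrix := by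
    calc (W * B)ᴴ * hMatrix * (W * B)
        = ((Φ⁻¹)ᴴ * Φᴴ) * ((W * B)ᴴ * hMatrix * (W * B)) * (Φ * Φ⁻¹) := by
          rw [hΦΦ, hΦΦ']; simp
      _ = (Φ⁻¹)ᴴ * ((B * Φ)ᴴ * (Wᴴ * hMatrix * W) * (B * Φ)) * Φ⁻¹ := by
          simp only [Matrix.conjTranspose_mul, Matrix.mul_assoc]
      _ = (Φ⁻¹)ᴴ * (Φᴴ * hMatrix * Φ) * Φ⁻¹ := by rw [hBΦ, hW, hgram]
      _ = ((Φ⁻¹)ᴴ * Φᴴ) * hMatrix * (Φ * Φ⁻¹) := by simp only [Matrix.mul_assoc]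
      _ = hMatrix := by rw [hΦΦ, hΦΦ']; simp
  obtain ⟨z, A, hA, hAz⟩ := exists_crGroup_smul hunit
  refine ⟨z, A, hA, fun t => ?_⟩
  have hBt : B *ᵥ Γ t = fun j => Complex.exp (Complex.I * μ j * t) := by
    ext j
    rw [hBz, hL, F.herm_eigenvector (hμC j), neg_neg]
  rw [hAz, Matrix.smul_mulVec, ← Matrix.mulVec_mulVec, hBt]

/-! ### Orbits of the maximal torus -/

/-- The point with homogeneous coordinates `e^{iA}, e^{iB}, e^{iC}` with respect to the columns of
`torusBasis r`. -/
def torusPoint (r A B C : ℝ) : C3 :=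
  ![((2 + r ^ 2) * Complex.exp (A * Complex.I) + (2 - r ^ 2) * Complex.exp (C * Complex.I)) / 4,
    r * Complex.exp (B * Complex.I),
    Complex.I * ((2 + r ^ 2) * Complex.exp (A * Complex.I)
      - (2 - r ^ 2) * Complex.exp (C * Complex.I)) / 4]

/-- The components of the point `[1, r, i r² / 2]` in the three eigenspaces of the maximal torus,
as columns of a matrix. -/
def torusBasis (r : ℝ) : Matrix (Fin 3) (Fin 3) ℂ :=
  !![(2 + (r : ℂ) ^ 2) / 4, 0, (2 - (r : ℂ) ^ 2) / 4;
     0, r, 0;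
     Complex.I * (2 + (r : ℂ) ^ 2) / 4, 0, -(Complex.I * (2 - (r : ℂ) ^ 2)) / 4]

theorem torusBasis_mulVec (r A B C : ℝ) :
    torusBasis r *ᵥ ![Complex.exp (A * Complex.I), Complex.exp (B * Complex.I),
      Complex.exp (C * Complex.I)] = torusPoint r A B C := by
  ext i
  fin_cases i <;> simp [torusBasis, torusPoint, Matrix.mulVec, dotProduct, Fin.sum_univ_three] <;>
    ring

theorem torusBasis_gram (r : ℝ) :
    (torusBasis r)ᴴ * hMatrix * torusBasis r
      = Matrix.diagonal ![-(2 + (r : ℂ) ^ 2) ^ 2 / 8, (r : ℂ) ^ 2, (2 - (r : ℂ) ^ 2) ^ 2 / 8] := by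
  have hI := Complex.I_sq
  ext i j
  fin_cases i <;> fin_cases j <;>
    simp [torusBasis, hMatrix, Matrix.mul_apply, Fin.sum_univ_three, map_ofNat] <;> ring_nf <;>
    simp only [hI] <;> ring

/-- The denominator of the profile. -/
def profileDenom (r θ : ℝ) : ℝ := 4 + r ^ 4 + (4 - r ^ 4) * Real.cos θ

theorem four_sub_pow_pos {r : ℝ} (hr : 0 < r) (hr2 : r < Real.sqrt 2) :
    r ^ 2 < 2 ∧ 0 < 4 - r ^ 4 := by
  have h : r ^ 2 < 2 := (Real.lt_sqrt hr.le).1 hr2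
  exact ⟨h, by nlinarith [sq_nonneg r]⟩

theorem profileDenom_pos {r : ℝ} (hr : 0 < r) (hr2 : r < Real.sqrt 2) (θ : ℝ) :
    0 < profileDenom r θ := by
  have h := (four_sub_pow_pos hr hr2).2
  have h1 := Real.neg_one_le_cos θ
  have h2 : 0 < r ^ 4 := by positivity
  rw [profileDenom]
  nlinarith

theorem profile_zero (r θ : ℝ) : profile r θ 0
    = 2 * r * ((2 + r ^ 2 + (2 - r ^ 2) * Real.cos θ) / profileDenom r θ) := rfl

theorem profile_one (r θ : ℝ) : profile r θ 1
    = -(2 * r * (r ^ 2 - 2) * Real.sin θ / profileDenom r θ) := rfl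

theorem profile_two (r θ : ℝ) : profile r θ 2
    = (r ^ 4 - 4) * Real.sin θ / profileDenom r θ := rfl

theorem profile_sq_add_sq {r : ℝ} (hr : 0 < r) (hr2 : r < Real.sqrt 2) (θ : ℝ) :
    profile r θ 0 ^ 2 + profile r θ 1 ^ 2 = 8 * r ^ 2 / profileDenom r θ := by
  have hD := (profileDenom_pos hr hr2 θ).ne'
  have hs := Real.sin_sq_add_cos_sq θ
  rw [profile_zero, profile_one]
  field_simp
  rw [profileDenom]
  linear_combination 4 * (2 - r ^ 2) ^ 2 * hs

theorem rotZ_sq_add_sq (θ : ℝ) (v : Fin 3 → ℝ) :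
    rotZ θ v 0 ^ 2 + rotZ θ v 1 ^ 2 = v 0 ^ 2 + v 1 ^ 2 := by
  have hs := Real.sin_sq_add_cos_sq θ
  simp only [rotZ, Matrix.cons_val_zero, Matrix.cons_val_one]
  linear_combination (v 0 ^ 2 + v 1 ^ 2) * hs

theorem torusPoint_zero_ne_zero {r : ℝ} (hr : 0 < r) (hr2 : r < Real.sqrt 2) (A B C : ℝ) :
    torusPoint r A B C 0 ≠ 0 := by
  intro h
  have h2 := (four_sub_pow_pos hr hr2).1
  have h3 : (((2 + r ^ 2 : ℝ) : ℂ)) * Complex.exp (A * Complex.I)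
      = ((-(2 - r ^ 2) : ℝ) : ℂ) * Complex.exp (C * Complex.I) := by
    simp only [torusPoint, Matrix.cons_val_zero] at h
    push_cast
    linear_combination 4 * h
  have h4 := congrArg norm h3
  rw [norm_mul, norm_mul, Complex.norm_exp_ofReal_mul_I, Complex.norm_exp_ofReal_mul_I,
    Complex.norm_real, Complex.norm_real, norm_neg, Real.norm_of_nonneg (by positivity),
    Real.norm_of_nonneg (by linarith)] at h4
  nlinarith [sq_nonneg r]

theorem torusPoint_ne_zero {r : ℝ} (hr : 0 < r) (hr2 : r < Real.sqrt 2) (A B C : ℝ) :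
    torusPoint r A B C ≠ 0 :=
  fun h => torusPoint_zero_ne_zero hr hr2 A B C (congrFun h 0)

/-- The torus orbits in the Heisenberg picture: `B - A` is the rotation around the axis and
`A - C` the parameter of the profile. -/
theorem mk_torusPoint {r : ℝ} (hr : 0 < r) (hr2 : r < Real.sqrt 2) (A B C : ℝ) :
    Projectivization.mk ℂ (torusPoint r A B C) (torusPoint_ne_zero hr hr2 A B C)
      = heisenbergInv (rotZ (B - A) (profile r (A - C))) := by
  rw [heisenbergInv, Projectivization.mk_eq_mk_iff']
  refine ⟨torusPoint r A B C 0, ?_⟩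
  rw [rotZ_sq_add_sq, profile_sq_add_sq hr hr2]
  have hD : (profileDenom r (A - C) : ℂ) ≠ 0 :=
    Complex.ofReal_ne_zero.2 (profileDenom_pos hr hr2 (A - C)).ne'
  have hD' : (profileDenom r (A - C) : ℂ)
      = 4 + (r : ℂ) ^ 4 + (4 - (r : ℂ) ^ 4) * Complex.cos ((A - C : ℝ) : ℂ) := by
    simp [profileDenom]
  have hA : Complex.exp (A * Complex.I) = Complex.exp (C * Complex.I) *
      (Complex.cos ((A - C : ℝ) : ℂ) + Complex.sin ((A - C : ℝ) : ℂ) * Complex.I) := by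
    rw [← Complex.exp_mul_I, ← Complex.exp_add]; congr 1; push_cast; ring
  have hB : Complex.exp (B * Complex.I) = Complex.exp (A * Complex.I) *
      (Complex.cos ((B - A : ℝ) : ℂ) + Complex.sin ((B - A : ℝ) : ℂ) * Complex.I) := by
    rw [← Complex.exp_mul_I, ← Complex.exp_add]; congr 1; push_cast; ring
  have hI := Complex.I_sq
  have hs := Complex.sin_sq_add_cos_sq ((A - C : ℝ) : ℂ)
  rw [Complex.ofReal_sub] at hs
  ext i
  fin_cases i
  · simp
  · simp [torusPoint, rotZ, profile_zero, profile_one, hB, hA] at hD' ⊢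
    field_simp
    generalize Complex.exp (↑C * Complex.I) = e at *
    generalize Complex.cos (↑A - ↑C) = x at *
    generalize Complex.sin (↑A - ↑C) = y at *
    generalize Complex.cos (↑B - ↑A) = u at *
    generalize Complex.sin (↑B - ↑A) = v at *
    rw [hD']
    linear_combination (-8 * r * x * y * v - 8 * r * y * v + 8 * r * y ^ 2 * u + 8 * r ^ 3 * y * v
      + 2 * r ^ 5 * x * y * v - 2 * r ^ 5 * y * v - 2 * r ^ 5 * y ^ 2 * u) * hI
      + (2 * r ^ 5 - 8 * r) * (u + Complex.I * v) * hs
  · simp [torusPoint, rotZ, profile_two, hA] at hD' ⊢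
    field_simp
    generalize Complex.exp (↑C * Complex.I) = e at *
    generalize Complex.cos (↑A - ↑C) = x at *
    generalize Complex.sin (↑A - ↑C) = y at *
    rw [hD']
    linear_combination (-8 * r ^ 2 * x * y + 8 * r ^ 2 * y + 4 * r ^ 4 * x * y + 4 * r ^ 4 * y
      + 2 * r ^ 6 * x * y - 2 * r ^ 6 * y - 16 * x * y - 16 * y) * hI
      + Complex.I * (-8 * r ^ 2 + 4 * r ^ 4 + 2 * r ^ 6 - 16) * hs

/-! ### The solenoids as models of the curves of constant curvature -/

theorem matrix_smul_mk (A : Matrix.SpecialLinearGroup (Fin 3) ℂ) {z w : C3} (hz : z ≠ 0)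
    (hw : w ≠ 0) {k : ℂ} (h : (A : Matrix (Fin 3) (Fin 3) ℂ) *ᵥ z = k • w) :
    A • Projectivization.mk ℂ z hz = Projectivization.mk ℂ w hw := by
  rw [Projectivization.smul_mk, Projectivization.mk_eq_mk_iff']
  exact ⟨k, h.symm⟩

theorem conjTranspose_vandermonde_apply (μ : Fin 3 → ℝ) (a j : Fin 3) :
    (Matrix.of fun j a : Fin 3 => (Complex.I * μ j) ^ (a : ℕ))ᴴ a j
      = (-(Complex.I * μ j)) ^ (a : ℕ) := by
  simp [Matrix.conjTranspose_apply]

/-- The solenoid with parameter `q`, traversed with speed `κ`, is a curve with the Gram matrix of a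
Frenet frame once its homogeneous coordinates are scaled by a suitable `ρ`. -/
theorem exists_solenoid_gram {q κ : ℝ} (hq : 1 < q) (hκ : κ ≠ 0) {μ : Fin 3 → ℝ}
    (hμ : μ = ![κ * (1 - q) / 3, κ * (2 * q + 1) / 3, -(κ * (q + 2)) / 3]) :
    ∃ ρ : ℂ, (Matrix.of fun j a : Fin 3 => (Complex.I * μ j) ^ (a : ℕ))ᴴ *
      ((ρ • torusBasis (rParam q))ᴴ * hMatrix * (ρ • torusBasis (rParam q))) *
      (Matrix.of fun j a : Fin 3 => (Complex.I * μ j) ^ (a : ℕ))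
      = frenetGram (κ ^ 2 * (q ^ 2 + q + 1) / 6) := by
  obtain ⟨w, hw0, hw1, hw, hr, hr0⟩ := exists_rParam_sq hq
  have hX : 0 < 2 * w * κ ^ 2 * q * (q + 1) := by
    have : 0 < q := by linarith
    positivity
  set ρ : ℝ := Real.sqrt (2 * w * κ ^ 2 * q * (q + 1))⁻¹ with hρ
  have hρ2 : ρ ^ 2 * (2 * w * κ ^ 2 * q * (q + 1)) = 1 := by
    rw [hρ, Real.sq_sqrt (by positivity), inv_mul_cancel₀ hX.ne']
  have hρ2' : (ρ : ℂ) ^ 2 * (2 * w * κ ^ 2 * q * (q + 1)) = 1 := by exact_mod_cast hρ2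
  have hrC : (rParam q : ℂ) ^ 2 = 2 * w := by exact_mod_cast hr
  have hwC : (w : ℂ) ^ 2 + 1 = (4 * q + 2) * w := by exact_mod_cast hw
  refine ⟨ρ, ?_⟩
  -- The squared lengths of the three eigencomponents are in the ratio `-(q + 1) : 1 : q`.
  have hgram : ((ρ : ℂ) • torusBasis (rParam q))ᴴ * hMatrix * ((ρ : ℂ) • torusBasis (rParam q))
      = Matrix.diagonal ![-((ρ : ℂ) ^ 2 * (2 * w) * (q + 1)), (ρ : ℂ) ^ 2 * (2 * w),
        (ρ : ℂ) ^ 2 * (2 * w) * q] := by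
    rw [Matrix.conjTranspose_smul, Matrix.smul_mul, Matrix.smul_mul, Matrix.mul_smul, smul_smul,
      torusBasis_gram, hrC, ← Matrix.diagonal_smul, Complex.star_def, Complex.conj_ofReal]
    congr 1
    ext i
    fin_cases i
    · simp
      linear_combination (-(ρ : ℂ) ^ 2 / 2) * hwC
    · simp [sq]
    · simp
      linear_combination ((ρ : ℂ) ^ 2 / 2) * hwC
  rw [hgram]
  have e0 : (μ 0 : ℂ) = κ * (1 - q) / 3 := by simp [hμ]
  have e1 : (μ 1 : ℂ) = κ * (2 * q + 1) / 3 := by simp [hμ]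
  have e2 : (μ 2 : ℂ) = -(κ * (q + 2)) / 3 := by simp [hμ]
  have hI := Complex.I_sq
  ext a b
  simp only [Matrix.mul_apply, Fin.sum_univ_three,
    conjTranspose_vandermonde_apply, Matrix.of_apply, e0, e1, e2, frenetGram]
  fin_cases a <;> fin_cases b <;> simp
  · ring
  · ring
  · linear_combination Complex.I ^ 2 * hρ2' + hI
  · ring
  · linear_combination -Complex.I ^ 2 * hρ2' - hI
  · ring
  · linear_combination Complex.I ^ 2 * hρ2' + hI
  · ring
  · linear_combination (Complex.I ^ 4 * κ ^ 2 * (q ^ 2 + q + 1) / 3) * hρ2'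
      + (κ ^ 2 * (q ^ 2 + q + 1) / 3 * (Complex.I ^ 2 - 1)) * hI

/-- A curve with constant curvature `𝚌(q)` is cr-equivalent to the solenoid with parameter `q`. -/
theorem HasConstantCurvature.crEquivalent_solenoid {γ : ℝ → ℙ ℂ C3} {q : ℝ} (hq : 1 < q)
    (hc : HasConstantCurvature γ (cParam q)) :
    CREquivalent γ fun t => heisenbergInv (solenoid q t) := by
  obtain ⟨h₀, hh₀, hnat⟩ := hc
  obtain ⟨ε, hε, Γ, G₁, G₂, F, hΓ⟩ := hnat.exists_frenetFrame
  obtain ⟨k, hk, hkP⟩ := exists_scale hq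
  have hr0 := rParam_pos hq
  have hr2 := rParam_lt_sqrt_two hq
  have hε2 : ε ^ 2 = 1 := by rcases hε with rfl | rfl <;> norm_num
  have hε0 : ε ≠ 0 := by rintro rfl; norm_num at hε2
  set κ := -(ε * k) with hκ
  have hκ0 : κ ≠ 0 := neg_ne_zero.2 (mul_ne_zero hε0 hk.ne')
  have hcκ : cParam q = κ ^ 2 * (q ^ 2 + q + 1) / 6 := by
    rw [cParam_eq hq hk hkP, hκ]
    linear_combination (-(k ^ 2 * (q ^ 2 + q + 1) / 6)) * hε2
  have hεκ : ε = -((2 * q + 1) * (q - 1) * (q + 2) * κ ^ 3 / 27) := by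
    rw [hκ]
    linear_combination (-ε * ε ^ 2 / 27) * hkP - ε * hε2
  obtain ⟨ρ, hgram⟩ := exists_solenoid_gram hq hκ0 rfl
  rw [hcκ] at F
  obtain ⟨z, A, hA, hAΓ⟩ := F.exists_congruence (fun j => by
    rw [hεκ]
    fin_cases j <;> simp <;> ring) hgram
  refine ⟨A, hA, fun t => h₀ (t / κ), ⟨hh₀.1.comp (contDiff_id.div_const κ), ?_, fun t => ?_⟩,
    fun t => ?_⟩
  · exact hh₀.2.1.comp (mulRight_bijective₀ κ⁻¹ (inv_ne_zero hκ0))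
  · have h1 := ((hh₀.1.differentiable (by simp)) (t / κ)).hasDerivAt
    have h2 := h1.comp t ((hasDerivAt_id t).div_const κ)
    have h3 : deriv (fun t => h₀ (t / κ)) t = deriv h₀ (t / κ) * (1 / κ) := h2.deriv
    rw [h3]
    exact mul_ne_zero (hh₀.2.2 _) (one_div_ne_zero hκ0)
  · obtain ⟨hz', e⟩ := hΓ (t / κ)
    have e' : γ (h₀ (t / κ)) = _ := e
    have harg := mk_torusPoint hr0 hr2 (κ * (1 - q) / 3 * (t / κ)) (κ * (2 * q + 1) / 3 * (t / κ))
      (-(κ * (q + 2)) / 3 * (t / κ))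
    rw [show κ * (2 * q + 1) / 3 * (t / κ) - κ * (1 - q) / 3 * (t / κ) = q * t by field_simp; ring,
      show κ * (1 - q) / 3 * (t / κ) - -(κ * (q + 2)) / 3 * (t / κ) = t by field_simp; ring]
      at harg
    rw [e']
    simp only [solenoid]
    rw [← harg]
    refine (matrix_smul_mk (k := z * ρ) A hz' _ ?_).symm
    rw [hAΓ, Matrix.smul_mulVec, smul_smul, ← torusBasis_mulVec]
    congr 2
    ext j
    fin_cases j <;> simp <;> ring_nf

/-- A curve cr-equivalent to a periodic one is closed. -/
theorem CREquivalent.isClosedCurve {γ δ : ℝ → ℙ ℂ C3} (h : CREquivalent γ δ) {T : ℝ} (hT : 0 < T)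
    (hδ : Function.Periodic δ T) : IsClosedCurve γ := by
  obtain ⟨A, -, g, hg, hδγ⟩ := h
  refine ⟨g, hg, T, hT, fun t => ?_⟩
  have : A • γ (g (t + T)) = A • γ (g t) := by rw [← hδγ, ← hδγ, hδ]
  exact smul_left_cancel A this

/-! ### Heisenberg cyclides as torus orbits -/

/-- The matrix `torusConj` and its inverse, which is its adjoint, in terms of `s = 1 / √2`. -/
theorem exists_torusConj_eq : ∃ s : ℂ, s ^ 2 = 1 / 2 ∧
    torusConj = !![s, 0, Complex.I * s; 0, 1, 0; Complex.I * s, 0, s] ∧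
    torusConj⁻¹ = !![s, 0, -(Complex.I * s); 0, 1, 0; -(Complex.I * s), 0, s] := by
  have hs : ((Real.sqrt 2 : ℂ)⁻¹) ^ 2 = 1 / 2 := by
    rw [inv_pow, one_div, inv_inj]
    exact_mod_cast Real.sq_sqrt (show (0 : ℝ) ≤ 2 by norm_num)
  have hI := Complex.I_sq
  have h : torusConj = !![(Real.sqrt 2 : ℂ)⁻¹, 0, Complex.I * (Real.sqrt 2 : ℂ)⁻¹; 0, 1, 0;
      Complex.I * (Real.sqrt 2 : ℂ)⁻¹, 0, (Real.sqrt 2 : ℂ)⁻¹] := by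
    simp [torusConj, div_eq_mul_inv]
  refine ⟨(Real.sqrt 2 : ℂ)⁻¹, hs, h, ?_⟩
  refine Matrix.inv_eq_right_inv ?_
  rw [h]
  generalize (Real.sqrt 2 : ℂ)⁻¹ = s at *
  ext i j
  fin_cases i <;> fin_cases j <;> simp [Matrix.mul_apply, Fin.sum_univ_three]
  · linear_combination 2 * hs - s ^ 2 * hI
  · ring
  · ring
  · linear_combination 2 * hs - s ^ 2 * hI

theorem torusMatrix_eq (θ φ : ℝ) : torusMatrix θ φ =
    !![(Complex.exp (θ * Complex.I) + Complex.exp (-(φ + θ) * Complex.I)) / 2, 0,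
        -(Complex.I * (Complex.exp (θ * Complex.I) - Complex.exp (-(φ + θ) * Complex.I)) / 2);
       0, Complex.exp (φ * Complex.I), 0;
       Complex.I * (Complex.exp (θ * Complex.I) - Complex.exp (-(φ + θ) * Complex.I)) / 2, 0,
        (Complex.exp (θ * Complex.I) + Complex.exp (-(φ + θ) * Complex.I)) / 2] := by
  have hI := Complex.I_sq
  obtain ⟨s, hs, h, h'⟩ := exists_torusConj_eq
  rw [torusMatrix, h', h]
  generalize Complex.exp (θ * Complex.I) = a at *
  generalize Complex.exp (φ * Complex.I) = b at *
  generalize Complex.exp (-(φ + θ) * Complex.I) = c at *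
  ext i j
  fin_cases i <;> fin_cases j <;>
    simp [Matrix.mul_apply, Fin.sum_univ_three, Matrix.vecMul_diagonal]
  · linear_combination (a + c) * hs - s ^ 2 * c * hI
  · linear_combination (-Complex.I * (a - c)) * hs
  · linear_combination (Complex.I * (a - c)) * hs
  · linear_combination (a + c) * hs - s ^ 2 * a * hI

theorem exists_mem_maximalTorus (θ φ : ℝ) :
    ∃ A ∈ maximalTorus, (A : Matrix (Fin 3) (Fin 3) ℂ) = torusMatrix θ φ := by
  have hI := Complex.I_sq
  have hexp : Complex.exp (θ * Complex.I) * Complex.exp (φ * Complex.I) *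
      Complex.exp (-(φ + θ) * Complex.I) = 1 := by
    rw [← Complex.exp_add, ← Complex.exp_add, ← Complex.exp_zero]; congr 1; ring
  have hdet : (torusMatrix θ φ).det = 1 := by
    rw [torusMatrix_eq, Matrix.det_fin_three, ← hexp]
    generalize Complex.exp (θ * Complex.I) = a at *
    generalize Complex.exp (φ * Complex.I) = b at *
    generalize Complex.exp (-(φ + θ) * Complex.I) = c at *
    simp
    linear_combination (b * (a - c) ^ 2 / 4) * hI
  have hstar : ∀ x : ℝ, (starRingEnd ℂ) (Complex.exp (x * Complex.I)) *
      Complex.exp (x * Complex.I) = 1 := fun x => by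
    rw [← Complex.exp_conj, ← Complex.exp_add]; simp
  have h1 := hstar θ
  have h2 := hstar φ
  have h3 := hstar (-(φ + θ))
  push_cast at h3
  have hu : (torusMatrix θ φ)ᴴ * hMatrix * torusMatrix θ φ = hMatrix := by
    rw [torusMatrix_eq]
    generalize Complex.exp (θ * Complex.I) = a at *
    generalize Complex.exp (φ * Complex.I) = b at *
    generalize Complex.exp (-(φ + θ) * Complex.I) = c at *
    ext i j
    fin_cases i <;> fin_cases j <;>
      simp [hMatrix, Matrix.mul_apply, Fin.sum_univ_three, map_ofNat]
    · linear_combination (Complex.I ^ 2 / 2) * (h1 - h3)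
    · linear_combination (-Complex.I * (starRingEnd ℂ a - starRingEnd ℂ c) * (a - c) / 4) * hI
        + Complex.I / 2 * (h1 + h3)
    · linear_combination h2
    · linear_combination (Complex.I * (starRingEnd ℂ a - starRingEnd ℂ c) * (a - c) / 4) * hI
        - Complex.I / 2 * (h1 + h3)
    · linear_combination (Complex.I ^ 2 / 2) * (h1 - h3)
  exact ⟨⟨torusMatrix θ φ, hdet⟩, ⟨hu, θ, φ, rfl⟩, rfl⟩

theorem rotZ_profile_mem_heisenbergCyclide {r : ℝ} (hr : 0 < r) (hr2 : r < Real.sqrt 2)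
    (ψ θ : ℝ) : rotZ ψ (profile r θ) ∈ heisenbergCyclide r := by
  -- The exponents of the torus element, normalized to have sum zero.
  obtain ⟨A, hA, hAeq⟩ := exists_mem_maximalTorus ((θ - ψ) / 3) ((θ - ψ) / 3 + ψ)
  refine ⟨A • slicePoint r, ⟨A, hA, rfl⟩, ?_⟩
  have h := mk_torusPoint hr hr2 ((θ - ψ) / 3) ((θ - ψ) / 3 + ψ) ((θ - ψ) / 3 - θ)
  rw [add_sub_cancel_left, sub_sub_cancel] at h
  rw [← heisenbergProj_heisenbergInv (rotZ ψ (profile r θ)), ← h, slicePoint]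
  congr 1
  refine matrix_smul_mk (k := 1) A _ _ ?_
  have hI := Complex.I_sq
  have e : -((((θ - ψ) / 3 + ψ : ℝ) : ℂ) + ((θ - ψ) / 3 : ℝ)) = (((θ - ψ) / 3 - θ : ℝ) : ℂ) := by
    push_cast; ring
  rw [hAeq, torusMatrix_eq, one_smul, e]
  ext i
  fin_cases i <;> simp [torusPoint, Matrix.mulVec, dotProduct, Fin.sum_univ_three]
  · linear_combination (-(r : ℂ) ^ 2 * (Complex.exp ((θ - ψ) / 3 * Complex.I)
      - Complex.exp (((θ - ψ) / 3 - θ) * Complex.I)) / 4) * hI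
  · ring
  · ring

/-! ### Regularity and simplicity of the solenoids -/

theorem solenoid_sq_add_sq {q : ℝ} (hq : 1 < q) (t : ℝ) :
    solenoid q t 0 ^ 2 + solenoid q t 1 ^ 2
      = 8 * rParam q ^ 2 / profileDenom (rParam q) t := by
  have hr0 := rParam_pos hq
  rw [solenoid, rotZ_sq_add_sq, profile_sq_add_sq hr0 (rParam_lt_sqrt_two hq)]

theorem solenoid_two (q t : ℝ) : solenoid q t 2
    = (rParam q ^ 4 - 4) * Real.sin t / profileDenom (rParam q) t := rfl

theorem contDiff_solenoid {q : ℝ} (hq : 1 < q) : ContDiff ℝ ∞ (solenoid q) := by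
  have hr0 := rParam_pos hq
  have hD : ∀ t, profileDenom (rParam q) t ≠ 0 := fun t =>
    (profileDenom_pos hr0 (rParam_lt_sqrt_two hq) t).ne'
  have hDc : ContDiff ℝ ∞ (profileDenom (rParam q)) := by
    unfold profileDenom
    exact contDiff_const.add (contDiff_const.mul Real.contDiff_cos)
  have hc : ContDiff ℝ ∞ fun t : ℝ => Real.cos (q * t) :=
    Real.contDiff_cos.comp (contDiff_const.mul contDiff_id)
  have hs : ContDiff ℝ ∞ fun t : ℝ => Real.sin (q * t) :=
    Real.contDiff_sin.comp (contDiff_const.mul contDiff_id)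
  have hp0 : ContDiff ℝ ∞ fun t => profile (rParam q) t 0 := by
    simp only [profile_zero]
    exact contDiff_const.mul ((contDiff_const.add
      (contDiff_const.mul Real.contDiff_cos)).div hDc hD)
  have hp1 : ContDiff ℝ ∞ fun t => profile (rParam q) t 1 := by
    simp only [profile_one]
    exact ((contDiff_const.mul Real.contDiff_sin).div hDc hD).neg
  have hp2 : ContDiff ℝ ∞ fun t => profile (rParam q) t 2 := by
    simp only [profile_two]
    exact (contDiff_const.mul Real.contDiff_sin).div hDc hD
  rw [contDiff_pi]
  intro i
  fin_cases i
  · exact (hc.mul hp0).sub (hs.mul hp1)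
  · exact (hs.mul hp0).add (hc.mul hp1)
  · exact hp2

theorem hasDerivAt_profileDenom (r t : ℝ) :
    HasDerivAt (profileDenom r) (-((4 - r ^ 4) * Real.sin t)) t := by
  have h := ((Real.hasDerivAt_cos t).const_mul (4 - r ^ 4)).const_add (4 + r ^ 4)
  exact h.congr_deriv (by ring)

/-- The distance to the axis is critical only where the height is not. -/
theorem deriv_solenoid_ne_zero {q : ℝ} (hq : 1 < q) (t : ℝ) : deriv (solenoid q) t ≠ 0 := by
  intro h
  have hr0 := rParam_pos hq
  have hr2 := rParam_lt_sqrt_two hq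
  have h4 := (four_sub_pow_pos hr0 hr2).2
  have hD := (profileDenom_pos hr0 hr2 t).ne'
  have hD' := hasDerivAt_profileDenom (rParam q) t
  have hd : HasDerivAt (solenoid q) 0 t := by
    rw [← h]
    exact ((contDiff_solenoid hq).differentiable (by simp) t).hasDerivAt
  rw [hasDerivAt_pi] at hd
  have hsin : Real.sin t = 0 := by
    have h1 := ((hd 0).pow 2).add ((hd 1).pow 2)
    have h2 := hD'.fun_inv hD |>.const_mul (8 * rParam q ^ 2)
    have h3 : (fun s => solenoid q s 0) ^ 2 + (fun s => solenoid q s 1) ^ 2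
        = fun s => 8 * rParam q ^ 2 * (profileDenom (rParam q) s)⁻¹ :=
      funext fun s => solenoid_sq_add_sq hq s
    rw [h3] at h1
    have h5 := h2.unique h1
    simp at h5
    rcases h5 with h5 | h5
    · exact absurd h5 hr0.ne'
    · rcases h5 with (h5 | h5) | h5
      · exact absurd h5 h4.ne'
      · exact h5
      · exact absurd h5 hD
  have hcos : Real.cos t = 0 := by
    have h1 := hd 2
    have h2 := ((Real.hasDerivAt_sin t).const_mul (rParam q ^ 4 - 4)).fun_div hD' hD
    have h3 := h2.unique h1
    rw [hsin] at h3
    simp at h3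
    rcases h3 with (h3 | h3) | h3
    · linarith
    · exact h3
    · exact absurd h3 hD
  have := Real.sin_sq_add_cos_sq t
  rw [hsin, hcos] at this
  norm_num at this

/-- Two parameters of the same point differ by a common period of the two angles. -/
theorem exists_int_of_solenoid_eq {q : ℝ} (hq : 1 < q) {t t' : ℝ}
    (h : solenoid q t = solenoid q t') :
    (∃ j : ℤ, t - t' = 2 * Real.pi * j) ∧ ∃ i : ℤ, q * t - q * t' = 2 * Real.pi * i := by
  have hr0 := rParam_pos hq
  have hr2 := rParam_lt_sqrt_two hq
  have h4 := (four_sub_pow_pos hr0 hr2).2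
  have hD := profileDenom_pos hr0 hr2 t
  have hD' := profileDenom_pos hr0 hr2 t'
  have hDD : profileDenom (rParam q) t = profileDenom (rParam q) t' := by
    have h1 := solenoid_sq_add_sq hq t
    rw [h, solenoid_sq_add_sq hq t', div_eq_div_iff hD'.ne' hD.ne'] at h1
    exact mul_left_cancel₀ (by positivity) h1
  have hcos : Real.cos t = Real.cos t' := by
    simp only [profileDenom] at hDD
    exact mul_left_cancel₀ h4.ne' (by linarith)
  have hsin : Real.sin t = Real.sin t' := by
    have h1 := congrFun h 2
    rw [solenoid_two, solenoid_two, hDD, div_left_inj' hD'.ne'] at h1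
    exact mul_left_cancel₀ (by linarith : rParam q ^ 4 - 4 ≠ 0) h1
  have hprof : profile (rParam q) t = profile (rParam q) t' := by
    simp only [profile, hcos, hsin]
  set p := profile (rParam q) t with hp
  have hp0 : 0 < p 0 ^ 2 + p 1 ^ 2 := by
    rw [profile_sq_add_sq hr0 hr2]
    positivity
  have e0 : Real.cos (q * t) * p 0 - Real.sin (q * t) * p 1
      = Real.cos (q * t') * p 0 - Real.sin (q * t') * p 1 := by
    have := congrFun h 0
    simp only [solenoid] at this
    rw [← hprof] at this
    exact this
  have e1 : Real.sin (q * t) * p 0 + Real.cos (q * t) * p 1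
      = Real.sin (q * t') * p 0 + Real.cos (q * t') * p 1 := by
    have := congrFun h 1
    simp only [solenoid] at this
    rw [← hprof] at this
    exact this
  have hcq : Real.cos (q * t) = Real.cos (q * t') :=
    mul_right_cancel₀ hp0.ne' (by linear_combination p 0 * e0 + p 1 * e1)
  have hsq : Real.sin (q * t) = Real.sin (q * t') :=
    mul_right_cancel₀ hp0.ne' (by linear_combination p 0 * e1 - p 1 * e0)
  exact ⟨Real.Angle.angle_eq_iff_two_pi_dvd_sub.1 (Real.Angle.cos_sin_inj hcos hsin),
    Real.Angle.angle_eq_iff_two_pi_dvd_sub.1 (Real.Angle.cos_sin_inj hcq hsq)⟩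

theorem periodic_solenoid {m n : ℕ} (hn : 0 < n) :
    Function.Periodic (solenoid ((m : ℝ) / n)) (2 * Real.pi * n) := by
  intro t
  have hn' : (n : ℝ) ≠ 0 := by positivity
  have e1 : t + 2 * Real.pi * n = t + n * (2 * Real.pi) := by ring
  have e2 : (m : ℝ) / n * (t + 2 * Real.pi * n) = m / n * t + m * (2 * Real.pi) := by
    field_simp
  simp only [solenoid, rotZ, e2, Real.cos_add_nat_mul_two_pi, Real.sin_add_nat_mul_two_pi]
  simp only [profile, e1, Real.cos_add_nat_mul_two_pi, Real.sin_add_nat_mul_two_pi]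

theorem injOn_solenoid_neg {m n : ℕ} (hn : 0 < n) (hnm : n < m) (hmn : Nat.Coprime m n) :
    Set.InjOn (fun t => solenoid ((m : ℝ) / n) (-t)) (Set.Ico 0 (2 * Real.pi * n)) := by
  intro t ht t' ht' h
  have hπ := Real.pi_pos
  have hn' : (0 : ℝ) < n := by exact_mod_cast hn
  have hq : 1 < (m : ℝ) / n := by
    rw [one_lt_div hn']
    exact_mod_cast hnm
  obtain ⟨⟨j, hj⟩, ⟨i, hi⟩⟩ := exists_int_of_solenoid_eq hq h
  have hji : (m : ℝ) * j = n * i := by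
    have e : (2 * Real.pi) * ((m : ℝ) * j) = (2 * Real.pi) * (n * i) := by
      field_simp at hi
      linear_combination hi - m * hj
    exact mul_left_cancel₀ (by positivity) e
  have hji' : (m : ℤ) * j = n * i := by exact_mod_cast hji
  have hdvd : (n : ℤ) ∣ j :=
    (Nat.isCoprime_iff_coprime.2 hmn.symm).dvd_of_dvd_mul_left ⟨i, hji'⟩
  have hlt : |j| < (n : ℤ) := by
    rw [abs_lt]
    obtain ⟨h1, h2⟩ := ht
    obtain ⟨h3, h4⟩ := ht'
    constructor
    · have : -(n : ℝ) < j := by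
        by_contra hcon
        nlinarith
      exact_mod_cast this
    · have : (j : ℝ) < n := by
        by_contra hcon
        nlinarith
      exact_mod_cast this
  have hj0 : j = 0 := Int.eq_zero_of_abs_lt_dvd hdvd hlt
  rw [hj0] at hj
  simp at hj
  linarith

/-! ### Linking numbers of the solenoids -/

/-- A closed path which differs from `e^{iat}` by factors in the right half-plane has the winding
number of `e^{iat}`. -/
theorem hasWindingNumber_of_eq_exp_mul {f g₁ g₂ : ℝ → ℂ} {T a : ℝ} {k : ℤ}
    (hf : ∀ t : ℝ, f t = Complex.exp ((a * t : ℝ) * Complex.I) * g₁ t * g₂ t)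
    (hg₁ : Continuous g₁) (hg₂ : Continuous g₂) (h₁ : ∀ t, 0 < (g₁ t).re)
    (h₂ : ∀ t, 0 < (g₂ t).re) (hT₁ : g₁ T = g₁ 0) (hT₂ : g₂ T = g₂ 0)
    (hk : a * T = 2 * Real.pi * k) : HasWindingNumber f T k := by
  have harg : ∀ {g : ℝ → ℂ}, Continuous g → (∀ t, 0 < (g t).re) →
      Continuous fun t => (g t).arg := fun hg h =>
    continuous_iff_continuousAt.2 fun t =>
      (Complex.continuousAt_arg (Or.inl (h t))).comp hg.continuousAt
  have hne : ∀ {g : ℝ → ℂ}, (∀ t, 0 < (g t).re) → ∀ t, g t ≠ 0 := fun h t e => by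
    have := h t
    rw [e] at this
    exact lt_irrefl _ this
  refine ⟨fun t => a * t + (g₁ t).arg + (g₂ t).arg,
    ((continuous_const.mul continuous_id).add (harg hg₁ h₁)).add (harg hg₂ h₂),
    fun t => ⟨?_, ?_⟩, ?_⟩
  · rw [hf]
    exact mul_ne_zero (mul_ne_zero (Complex.exp_ne_zero _) (hne h₁ t)) (hne h₂ t)
  · have hn : ‖f t‖ = ‖g₁ t‖ * ‖g₂ t‖ := by
      rw [hf, norm_mul, norm_mul, Complex.norm_exp_ofReal_mul_I, one_mul]
    rw [hn, hf]
    push_cast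
    rw [add_mul, add_mul, Complex.exp_add, Complex.exp_add]
    conv_lhs =>
      rw [← Complex.norm_mul_exp_arg_mul_I (g₁ t), ← Complex.norm_mul_exp_arg_mul_I (g₂ t)]
    ring
  · simp only [hT₁, hT₂, mul_zero]
    linear_combination hk

theorem continuous_profileDenom (r : ℝ) : Continuous (profileDenom r) :=
  continuous_iff_continuousAt.2 fun t => (hasDerivAt_profileDenom r t).continuousAt

theorem profile_add_nat_mul (r t : ℝ) (n : ℕ) :
    profile r (t + n * (2 * Real.pi)) = profile r t := by
  simp only [profile, Real.cos_add_nat_mul_two_pi, Real.sin_add_nat_mul_two_pi]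

theorem linksAxis_solenoid_neg {m n : ℕ} (hn : 0 < n) (hnm : n < m) :
    LinksAxis (fun t => solenoid ((m : ℝ) / n) (-t)) (2 * Real.pi * n) (-(m : ℤ)) := by
  have hn' : (0 : ℝ) < n := by exact_mod_cast hn
  have hq : 1 < (m : ℝ) / n := by
    rw [one_lt_div hn']
    exact_mod_cast hnm
  have hr0 := rParam_pos hq
  have hr2 := rParam_lt_sqrt_two hq
  set r := rParam ((m : ℝ) / n) with hr
  have hD := profileDenom_pos hr0 hr2
  have hDc := continuous_profileDenom r
  -- The projection of the profile to the horizontal plane lies in the right half-plane.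
  refine hasWindingNumber_of_eq_exp_mul (a := -((m : ℝ) / n))
    (g₁ := fun t => (profile r (-t) 0 : ℂ) + profile r (-t) 1 * Complex.I) (g₂ := fun _ => 1)
    (fun t => ?_) ?_ continuous_const (fun t => ?_) (fun t => by simp) ?_ rfl ?_
  · have e : ((-((m : ℝ) / n) * t : ℝ) : ℂ) = (((m : ℝ) / n * -t : ℝ) : ℂ) := by push_cast; ring
    rw [e, Complex.exp_mul_I, ← Complex.ofReal_cos, ← Complex.ofReal_sin]
    simp only [solenoid, rotZ, Matrix.cons_val_zero, Matrix.cons_val_one, ← hr]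
    push_cast
    linear_combination (-Complex.sin ((m : ℂ) / n * -t) * (profile r (-t) 1 : ℂ)) * Complex.I_sq
  · simp only [profile_zero, profile_one]
    have h0 : Continuous fun t => profileDenom r (-t) := hDc.comp continuous_neg
    have h1 : ∀ t, profileDenom r (-t) ≠ 0 := fun t => (hD _).ne'
    refine (Complex.continuous_ofReal.comp ?_).add ((Complex.continuous_ofReal.comp ?_).mul
      continuous_const)
    · exact continuous_const.mul (Continuous.div (by fun_prop) h0 h1)
    · exact (Continuous.div (by fun_prop) h0 h1).neg
  · have h4 := (four_sub_pow_pos hr0 hr2).1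
    have h5 := Real.neg_one_le_cos (-t)
    have h6 : 0 < 2 + r ^ 2 + (2 - r ^ 2) * Real.cos (-t) := by nlinarith [sq_pos_of_pos hr0]
    simp only [Complex.add_re, Complex.ofReal_re, Complex.mul_re, Complex.ofReal_im, Complex.I_re,
      Complex.I_im, mul_zero, zero_mul, sub_zero, add_zero]
    rw [profile_zero]
    have := hD (-t)
    positivity
  · have e : profile r (-(2 * Real.pi * n)) = profile r (-0) := by
      rw [← profile_add_nat_mul r _ n]
      congr 1
      ring
    simp only [e]
  · push_cast
    field_simp

/-- The radial component `√2 - √(x² + y²)` of the path has the same sign as `cos t + b`, where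
`b = (2 - r²) / (2 + r²)`, and its height has the same sign as `sin t`. Hence the angle between the
path and the circle `e^{it} + b`, `0 < b < 1`, is always acute. -/
theorem linksCircle_solenoid_neg {m n : ℕ} (hn : 0 < n) (hnm : n < m) :
    LinksCircle (fun t => solenoid ((m : ℝ) / n) (-t)) (2 * Real.pi * n) (n : ℤ) := by
  have hn' : (0 : ℝ) < n := by exact_mod_cast hn
  have hq : 1 < (m : ℝ) / n := by
    rw [one_lt_div hn']
    exact_mod_cast hnm
  have hr0 := rParam_pos hq
  have hr2 := rParam_lt_sqrt_two hq
  obtain ⟨h2, h4⟩ := four_sub_pow_pos hr0 hr2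
  unfold LinksCircle
  simp only [solenoid_sq_add_sq hq, solenoid_two]
  set r := rParam ((m : ℝ) / n) with hr
  have hDeven : ∀ t, profileDenom r (-t) = profileDenom r t := fun t => by
    simp [profileDenom]
  simp only [hDeven, Real.sin_neg]
  have hD := profileDenom_pos hr0 hr2
  have hDc := continuous_profileDenom r
  set b := (2 - r ^ 2) / (2 + r ^ 2) with hb
  have hr2p : 0 < 2 + r ^ 2 := by positivity
  have hb0 : 0 < b := div_pos (by linarith) hr2p
  have hb1 : b < 1 := by rw [hb, div_lt_one hr2p]; nlinarith [sq_pos_of_pos hr0]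
  have hDb : ∀ t, profileDenom r t = 4 * r ^ 2 + (4 - r ^ 4) * (Real.cos t + b) := fun t => by
    rw [profileDenom, hb]
    field_simp
    ring
  set u : ℝ → ℝ := fun t => Real.sqrt 2 - Real.sqrt (8 * r ^ 2 / profileDenom r t) with hu
  set v : ℝ → ℝ := fun t => (r ^ 4 - 4) * -Real.sin t / profileDenom r t with hv
  set h : ℝ → ℂ := fun t => ((Real.cos t + b : ℝ) : ℂ) + (Real.sin t : ℝ) * Complex.I with hh
  have hhre : ∀ t, (h t).re = Real.cos t + b := fun t => by
    simp only [hh, Complex.add_re, Complex.ofReal_re, Complex.re_ofReal_mul, Complex.I_re,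
      mul_zero, add_zero]
  have hhim : ∀ t, (h t).im = Real.sin t := fun t => by
    simp only [hh, Complex.add_im, Complex.ofReal_im, Complex.im_ofReal_mul, Complex.I_im,
      mul_one, zero_add]
  have hpos : ∀ t, 0 < u t * (Real.cos t + b) + v t * Real.sin t := fun t => by
    have hDt := hD t
    have hvs : v t * Real.sin t = (4 - r ^ 4) / profileDenom r t * Real.sin t ^ 2 := by
      simp only [hv]; ring
    have hc : 0 < (4 - r ^ 4) / profileDenom r t := div_pos h4 hDt
    rw [hvs]
    rcases lt_trichotomy (Real.cos t + b) 0 with hk | hk | hk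
    · have : u t < 0 := by
        refine sub_neg.2 (Real.sqrt_lt_sqrt (by norm_num) ?_)
        rw [lt_div_iff₀ hDt, hDb]
        nlinarith
      have := mul_pos_of_neg_of_neg this hk
      positivity
    · rw [hk, mul_zero, zero_add]
      have hsin : 0 < Real.sin t ^ 2 := by
        have := Real.sin_sq_add_cos_sq t
        have hcos : Real.cos t = -b := by linarith
        rw [hcos] at this
        nlinarith
      positivity
    · have : 0 < u t := by
        refine sub_pos.2 (Real.sqrt_lt_sqrt (by positivity) ?_)
        rw [div_lt_iff₀ hDt, hDb]
        nlinarith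
      positivity
  have hh0 : ∀ t, h t ≠ 0 := fun t e => by
    have h1 := hhre t
    have h3 := hhim t
    rw [e, Complex.zero_re] at h1
    rw [e, Complex.zero_im] at h3
    have := hpos t
    rw [← h1, ← h3] at this
    simp at this
  have hhc : Continuous h := by
    simp only [hh]
    fun_prop
  have hfc : Continuous fun t => ((u t : ℝ) : ℂ) + (v t : ℝ) * Complex.I := by
    have hne : ∀ t, profileDenom r t ≠ 0 := fun t => (hD t).ne'
    refine (Complex.continuous_ofReal.comp ?_).add ((Complex.continuous_ofReal.comp ?_).mul
      continuous_const)
    · exact continuous_const.sub (Real.continuous_sqrt.comp (continuous_const.div hDc hne))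
    · exact Continuous.div (by fun_prop) hDc hne
  -- The path is compared with the circle `h t = e^{it} + b`, which winds once around the origin.
  refine hasWindingNumber_of_eq_exp_mul (a := 1)
    (g₁ := fun t => 1 + b * Complex.exp (-(t * Complex.I)))
    (g₂ := fun t => (((u t : ℝ) : ℂ) + (v t : ℝ) * Complex.I) / h t)
    (fun t => ?_) ?_ (hfc.div hhc hh0) (fun t => ?_) (fun t => ?_) ?_ ?_ ?_
  · have e : Complex.exp ((1 * t : ℝ) * Complex.I) * (1 + b * Complex.exp (-(t * Complex.I)))
        = h t := by
      have e1 : Complex.exp (t * Complex.I) * Complex.exp (-(t * Complex.I)) = 1 := by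
        rw [← Complex.exp_add, add_neg_cancel, Complex.exp_zero]
      rw [one_mul]
      simp only [hh]
      push_cast
      rw [← sub_eq_zero]
      linear_combination (b : ℂ) * e1 + Complex.exp_mul_I t
    rw [e, mul_div_cancel₀ _ (hh0 t)]
  · fun_prop
  · have e : Complex.exp (-(t * Complex.I)) = Complex.exp (((-t : ℝ) : ℂ) * Complex.I) := by
      push_cast; rw [neg_mul]
    simp only [e, Complex.add_re, Complex.one_re, Complex.re_ofReal_mul,
      Complex.exp_ofReal_mul_I_re]
    nlinarith [Real.neg_one_le_cos (-t)]
  · have hns : 0 < Complex.normSq (h t) := Complex.normSq_pos.2 (hh0 t)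
    rw [Complex.div_re, hhre, hhim, ← add_div]
    refine div_pos ?_ hns
    simpa using hpos t
  · have e : -(((2 * Real.pi * n : ℝ) : ℂ) * Complex.I) = (-n : ℤ) * (2 * Real.pi * Complex.I) := by
      push_cast; ring
    simp only [e, Complex.exp_int_mul_two_pi_mul_I]
    simp
  · have e : 2 * Real.pi * n = 0 + n * (2 * Real.pi) := by ring
    simp only [hu, hv, hh, profileDenom, e, Real.cos_add_nat_mul_two_pi,
      Real.sin_add_nat_mul_two_pi]
  · push_cast
    ring

/-- The solenoid of a rational parameter, traversed backwards, is a solenoidal torus knot. -/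
theorem isSolenoidalTorusKnot_solenoid_neg {m n : ℕ} (hn : 0 < n) (hnm : n < m)
    (hmn : Nat.Coprime m n) :
    IsSolenoidalTorusKnot (rParam ((m : ℝ) / n)) (2 * Real.pi * n) (-(m : ℤ)) (n : ℤ)
      (fun t => solenoid ((m : ℝ) / n) (-t)) := by
  have hn' : (0 : ℝ) < n := by exact_mod_cast hn
  have hq : 1 < (m : ℝ) / n := by
    rw [one_lt_div hn']
    exact_mod_cast hnm
  have hr0 := rParam_pos hq
  have hr2 := rParam_lt_sqrt_two hq
  exact
    { parameter := ⟨hr0, hr2⟩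
      period_pos := by have := Real.pi_pos; positivity
      smooth := (contDiff_solenoid hq).comp contDiff_neg
      regular := fun t => by
        rw [deriv_comp_neg]
        exact neg_ne_zero.2 (deriv_solenoid_ne_zero hq (-t))
      periodic := fun t => by
        have h := periodic_solenoid (m := m) hn (-(t + 2 * Real.pi * n))
        rw [neg_add, neg_add_cancel_right] at h
        simp only [neg_add]
        exact h.symm
      simple := injOn_solenoid_neg hn hnm hmn
      mem_cyclide := fun t => rotZ_profile_mem_heisenbergCyclide hr0 hr2 _ _
      solenoidal := ⟨-((m : ℝ) / n), -1, fun t => by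
        rw [solenoid, neg_one_mul, neg_mul, mul_neg]⟩
      links_axis := linksAxis_solenoid_neg hn hnm
      links_core := linksCircle_solenoid_neg hn hnm }

theorem exists_nat_div_eq {q : ℚ} (hq : 1 < q) :
    ∃ m n : ℕ, 0 < n ∧ (q : ℝ) = (m : ℝ) / n := by
  refine ⟨q.num.toNat, q.den, q.den_pos, ?_⟩
  have h : ((q.num.toNat : ℤ) : ℝ) = (q.num : ℝ) := by
    rw [Int.toNat_of_nonneg (Rat.num_nonneg.2 (by linarith))]
  rw [Rat.cast_def, ← h, Int.cast_natCast]

end CRSphere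

end

theorem theoremS3p6 (γ : ℝ → ℙ ℂ C3) (c : ℝ) (hγ : IsGeneric γ)
    (hc : HasConstantCurvature γ c) :
    (IsClosedCurve γ ↔ ∃ q : ℚ, 1 < q ∧ c = cParam (q : ℝ)) ∧
    ∀ m n : ℕ, 0 < n → n < m → Nat.Coprime m n → c = cParam ((m : ℝ) / (n : ℝ)) →
      CREquivalent γ (fun t => heisenbergInv (solenoid ((m : ℝ) / (n : ℝ)) t)) ∧
      IsSolenoidalTorusKnot (rParam ((m : ℝ) / (n : ℝ))) (2 * Real.pi * n) (-(m : ℤ)) (n : ℤ)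
        (fun t => solenoid ((m : ℝ) / (n : ℝ)) (-t)) := by
  refine ⟨⟨fun h => h.exists_rat hc, ?_⟩, fun m n hn hnm hmn hcq => ?_⟩
  · rintro ⟨q, hq, rfl⟩
    obtain ⟨m, n, hn, hmn⟩ := exists_nat_div_eq hq
    have hq' : (1 : ℝ) < q := by exact_mod_cast hq
    have h := hc.crEquivalent_solenoid hq'
    have hT : 0 < 2 * Real.pi * n := by
      have := Real.pi_pos
      positivity
    refine h.isClosedCurve hT fun t => ?_
    simp only [hmn, periodic_solenoid hn t]
  · have hn' : (0 : ℝ) < n := by exact_mod_cast hn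
    have hq : 1 < (m : ℝ) / n := by
      rw [one_lt_div hn']
      exact_mod_cast hnm
    subst hcq
    exact ⟨hc.crEquivalent_solenoid hq, isSolenoidalTorusKnot_solenoid_neg hn hnm hmn⟩
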